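/- **Setting.** Let $\kappa,\sigma,\nu,\lambda>0$, $y_0\in\mathbb R$, $T\ge 1/\lambda$, and let $\mu$ be integrable on $[0,T]$. On a probability space let $W$ be a Brownian motion, $N$ a homogeneous Poisson process with intensity $\nu$ and jump times $t_1<t_2<\cdots$, and $(\gamma_{t_i})_{i\ge1}$ i.i.d. jump heights with a given law that has a finite second moment and mean $\bar\gamma$; $W$ and $N$ are independent, and the jump heights are independent of $(W,N)$. The demand $Y$ solves on $[0,T]$ $$dY_t=\kappa(\mu(t)-Y_t)\,dt+\sigma\,dW_t+\gamma_t\,dN_t,\qquad Y_0=y_0,\qquad \int_0^t\gamma_s\,dN_s=\sum_{i=1}^{N_t}\gamma_{t_i},$$ and $\mathcal F_t=\sigma(Y_s;\,0\le s\le t)$. A control $u$ on $[0,T-1/\lambda]$ enters at $x=0$ the line $z_t+\lambda z_x=0$, $z(x,0)=z_0(x)$, $z(0,t)=u(t)$, where $z_0$ is an arbitrary function, $z$ is the solution given by the method of characteristics, and the outflow is $y(t)=z(1,t)$. One minimizes $\int_{1/\lambda}^T\mathbb E[(Y_s-y(s))^2]\,ds$ over the controls $u\in L^2([0,T-1/\lambda]\times\Omega)$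 such that, for every $t\in[0,T-1/\lambda]$, * (CM2, updates at $\hat t_i=i\,\Delta t_{\rm up}$, $\Delta t_{\rm up}>0$) $u(t)$ is $\mathcal F_{\hat t_i}$-measurable, where $i$ is the index with $t\in[\hat t_i,\hat t_{i+1})$; * (CM3, idealized setting) $u(t)$ is $\mathcal F_t$-measurable. For $0\le r\le t\le T-1/\lambda$ put $$u^*(t;r)=e^{-\kappa(t+1/\lambda-r)}Y_r+\kappa\int_r^{t+1/\lambda}e^{-\kappa(t+1/\lambda-s)}\mu(s)\,ds+\frac{\bar\gamma\nu}{\kappa}\bigl(1-e^{-\kappa(t+1/\lambda-r)}\bigr),\qquad u^*(t)=u^*(t;t).$$ **Theorem 3.4.** For every $\Delta t_{\rm up}>0$, the control $t\mapsto u^*(t;\hat t_i)$, $t\in[\hat t_i,\hat t_{i+1})$, is the optimal control of CM2, and $t\mapsto u^*(t)$ is the optimal control of CM3: each has finite cost, minimizes the cost over the controls admitted in its setting, and is the only minimizer up to $dt\otimes\mathbb P$-null sets. Moreover $u^*(t;r)=\mathbb E[Y_{t+1/\lambda}\mid\mathcal F_r]$ almost surely for all $0\le r\le t\le T-1/\lambda$.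 As the time between the updates tends to zero, the optimal control with updates converges to the optimal control of the idealized setting: for every fixed $t\in[0,T-1/\lambda]$, with $\hat t_i=\hat t_i(\Delta t_{\rm up})$ the last update time not later than $t$, $$\lim_{\Delta t_{\rm up}\downarrow0}\bigl(u^*(t)-u^*(t;\hat t_i)\bigr)=0\qquad\mathbb P\text{-almost surely.}$$ -/

import Mathlib

open MeasureTheory ProbabilityTheory Filter Topology
open scoped NNReal ENNReal

namespace PowerSupply

variable {Ω : Type*} [MeasurableSpace Ω]

/-! ### The demand process -/

/-- `N` is a homogeneous Poisson process with intensity `ν`: it starts at `0`, has independent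
increments, `N t - N s` is Poisson distributed with parameter `ν (t - s)`, and almost every path
is nondecreasing and right-continuous. (As the paths are nondecreasing, the subtraction of natural
numbers in `law` is the true one almost surely.) -/
structure IsPoissonProcess (N : ℝ≥0 → Ω → ℕ) (ν : ℝ≥0) (P : Measure Ω) : Prop where
  measurable : ∀ t, Measurable (N t)
  zero : ∀ᵐ ω ∂P, N 0 ω = 0
  indep : HasIndepIncrements (fun t ω => (N t ω : ℝ)) P
  law : ∀ s t, s ≤ t → HasLaw (fun ω => N t ω - N s ω) (poissonMeasure (ν * (t - s))) P
  mono : ∀ᵐ ω ∂P, Monotone (N · ω)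
  right_cont : ∀ᵐ ω ∂P, ∀ t, ContinuousWithinAt (N · ω) (Set.Ici t) t

/-- `Y` solves on `[0, T]` the jump diffusion equation
`dY_t = κ (μ(t) - Y_t) dt + σ dW_t + γ_t dN_t`, `Y_0 = y₀`,
where `γ i` is the height of the jump at the `(i+1)`-st jump time of `N`, so that
`∫_0^t γ_s dN_s = ∑_{i < N_t} γ i`. The noise is additive, so that this is an equation between
paths. -/
def SolvesJumpDiffusion (κ σ y₀ : ℝ) (μ : ℝ → ℝ) (T : ℝ≥0) (W : ℝ≥0 → Ω → ℝ)
    (N : ℝ≥0 → Ω → ℕ) (γ : ℕ → Ω → ℝ) (Y : ℝ≥0 → Ω → ℝ) (P : Measure Ω) : Prop :=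
  ∀ᵐ ω ∂P,
    IntervalIntegrable (fun s : ℝ => Y s.toNNReal ω) volume 0 T ∧
    ∀ t : ℝ≥0, t ≤ T →
      Y t ω = y₀ + (∫ s in (0 : ℝ)..t, κ * (μ s - Y s.toNNReal ω)) + σ * W t ω
        + ∑ i ∈ Finset.range (N t ω), γ i ω

/-! ### Transport of the control through the line -/

/-- The solution (by characteristics) of `z_t + λ z_x = 0`, `z(x,0) = z₀(x)`, `z(0,t) = u(t)`. -/
noncomputable def transport (lam : ℝ≥0) (z₀ : ℝ → ℝ) (u : ℝ≥0 → ℝ) (x t : ℝ≥0) : ℝ :=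
  if lam * t < x then z₀ (x - lam * t) else u (t - x / lam)

/-- The outflow `y(t) = z(1,t)`. -/
noncomputable def outflow (lam : ℝ≥0) (z₀ : ℝ → ℝ) (u : ℝ≥0 → ℝ) (t : ℝ≥0) : ℝ :=
  transport lam z₀ u 1 t

theorem transport_initial (lam : ℝ≥0) (z₀ : ℝ → ℝ) (u : ℝ≥0 → ℝ) {x : ℝ≥0} (hx : 0 < x) :
    transport lam z₀ u x 0 = z₀ x := by
  simp [transport, hx]

theorem transport_inflow (lam : ℝ≥0) (z₀ : ℝ → ℝ) (u : ℝ≥0 → ℝ) (t : ℝ≥0) :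
    transport lam z₀ u 0 t = u t := by
  simp [transport]

/-- `z` is constant along the characteristics `x = x₀ + λ t`. -/
theorem transport_characteristic {lam : ℝ≥0} (hlam : 0 < lam) (z₀ : ℝ → ℝ) (u : ℝ≥0 → ℝ)
    (x t r : ℝ≥0) :
    transport lam z₀ u (x + lam * r) (t + r) = transport lam z₀ u x t := by
  have h : (lam * (t + r) < x + lam * r) ↔ (lam * t < x) := by
    rw [mul_add]; exact add_lt_add_iff_right _
  have e : (x + lam * r) / lam = x / lam + r := by
    field_simp
  simp only [transport, h, e, add_tsub_add_eq_tsub_right]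
  congr 2
  push_cast; ring

theorem outflow_add {lam : ℝ≥0} (hlam : 0 < lam) (z₀ : ℝ → ℝ) (u : ℝ≥0 → ℝ) (t : ℝ≥0) :
    outflow lam z₀ u (t + 1 / lam) = u t := by
  have h : ¬ lam * (t + 1 / lam) < 1 := by
    rw [not_lt, mul_add, mul_one_div_cancel hlam.ne']; exact le_add_self
  rw [outflow, transport, if_neg h, add_tsub_cancel_right]

/-! ### The control problem with restricted information -/

/-- The last of the update times `0, Δ, 2Δ, …` that is not later than `t`. -/
noncomputable def lastUpdate (Δ t : ℝ≥0) : ℝ≥0 := (⌊t / Δ⌋₊ : ℝ≥0) * Δ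

theorem lastUpdate_eq {Δ : ℝ≥0} (hΔ : 0 < Δ) {i : ℕ} {t : ℝ≥0}
    (ht : t ∈ Set.Ico (i * Δ) ((i + 1) * Δ)) : lastUpdate Δ t = i * Δ := by
  have : ⌊t / Δ⌋₊ = i := by
    rw [Nat.floor_eq_iff zero_le]
    exact ⟨(le_div_iff₀ hΔ).2 ht.1, (div_lt_iff₀ hΔ).2 ht.2⟩
  rw [lastUpdate, this]

/-- Admissible controls on `[0, T - 1/λ]` when at time `t` the demand is known up to the time
`τ t`: `u` is square integrable on `[0, T - 1/λ] × Ω`, and `u t` is measurable for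
`ℱ (τ t)`. The setting with regular updates is `τ = lastUpdate Δ`, the idealized one
is `τ t = t`. -/
structure IsAdmissible (lam T : ℝ≥0) (P : Measure Ω) (ℱ : Filtration ℝ≥0 ‹MeasurableSpace Ω›)
    (τ : ℝ≥0 → ℝ≥0) (u : ℝ≥0 → Ω → ℝ) : Prop where
  adapted : ∀ t, t + 1 / lam ≤ T → StronglyMeasurable[ℱ (τ t)] (u t)
  memLp : MemLp (fun p : ℝ × Ω => u p.1.toNNReal p.2) 2
    ((volume.restrict (Set.Icc (0 : ℝ) (T - 1 / lam))).prod P)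

/-- The objective `∫_{1/λ}^T 𝔼[(Y_s - y(s))²] ds`, with values in `[0, ∞]`. -/
noncomputable def cost (lam T : ℝ≥0) (z₀ : ℝ → ℝ) (P : Measure Ω) (Y u : ℝ≥0 → Ω → ℝ) : ℝ≥0∞ :=
  ∫⁻ s in Set.Icc (1 / lam : ℝ) T,
    ∫⁻ ω, ENNReal.ofReal
      ((Y s.toNNReal ω - outflow lam z₀ (fun t => u t ω) s.toNNReal) ^ 2) ∂P

/-- `u` minimizes the objective among the admissible controls. -/
def IsMinimizer (lam T : ℝ≥0) (z₀ : ℝ → ℝ) (P : Measure Ω)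
    (ℱ : Filtration ℝ≥0 ‹MeasurableSpace Ω›) (Y : ℝ≥0 → Ω → ℝ) (τ : ℝ≥0 → ℝ≥0)
    (u : ℝ≥0 → Ω → ℝ) : Prop :=
  IsAdmissible lam T P ℱ τ u ∧
    ∀ v, IsAdmissible lam T P ℱ τ v → cost lam T z₀ P Y u ≤ cost lam T z₀ P Y v

/-- `u` is the optimal control: it is a minimizer, with finite cost, and any other minimizer
agrees with it almost everywhere on `[0, T - 1/λ] × Ω`. -/
def IsOptimalControl (lam T : ℝ≥0) (z₀ : ℝ → ℝ) (P : Measure Ω)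
    (ℱ : Filtration ℝ≥0 ‹MeasurableSpace Ω›) (Y : ℝ≥0 → Ω → ℝ) (τ : ℝ≥0 → ℝ≥0)
    (u : ℝ≥0 → Ω → ℝ) : Prop :=
  IsMinimizer lam T z₀ P ℱ Y τ u ∧ cost lam T z₀ P Y u < ∞ ∧
    ∀ v, IsMinimizer lam T z₀ P ℱ Y τ v →
      ∀ᵐ p : ℝ × Ω ∂((volume.restrict (Set.Icc (0 : ℝ) (T - 1 / lam))).prod P),
        v p.1.toNNReal p.2 = u p.1.toNNReal p.2

/-- The control `u*(t; r)` computed from the demand observed at the time `r ≤ t`;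
`u*(t) = u*(t; t)`. Here `γbar` is the mean jump height. -/
noncomputable def control (κ γbar : ℝ) (ν lam : ℝ≥0) (μ : ℝ → ℝ) (Y : ℝ≥0 → Ω → ℝ)
    (t r : ℝ≥0) (ω : Ω) : ℝ :=
  Real.exp (-κ * (t + 1 / lam - r)) * Y r ω
    + κ * (∫ s in (r : ℝ)..(t + 1 / lam), Real.exp (-κ * (t + 1 / lam - s)) * μ s)
    + γbar * ν / κ * (1 - Real.exp (-κ * (t + 1 / lam - r)))

end PowerSupply

/-!
The optimal control forecasts the demand: by the translation `s = t + 1/λ` the line drops out of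
the objective (`cost_eq`), which becomes the integral over `t` of `𝔼[(Y_{t+1/λ} - u_t)²]`. For a
control that at time `t` may use the demand up to time `τ t`, Pythagoras' theorem
(`lintegral_sq_sub_eq_add`) splits this into the cost of `𝔼[Y_{t+1/λ} | ℱ_{τ t}]` and the squared
distance in `L²([0, T - 1/λ] × Ω)` from it; hence minimality and uniqueness
(`IsDemandNoise.cost_eq_cost_control_add`, `IsDemandNoise.isOptimalControl`). Both settings are
instances, `τ` being the last update time or the identity.

The main point is that `u*(t; r)` is this conditional expectation
(`IsDemandNoise.control_ae_eq_condExp`). As the noise is additive, the equation is solved path by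
path (`IsPathSolution.eq_explicit`) and no stochastic integral is needed. Let `A` be an event that
can be read off the demand up to time `r`. If on `A` the increments of the noise keep their
unconditional mean `γ̄ ν (t - r)`, then `t ↦ 𝔼[Y_t; A]` solves a linear integral equation, and
variation of constants (`eq_of_linear_integral_equation`) gives the formula for `u*(t; r)`
(`IsDemandNoise.setIntegral_demand`).

The increments of the noise are split into those of `W`, those of `N` and the compensated jumps
(`IsDemandNoise.setIntegral_noise_increment`). The demand up to time `r` is, up to null sets, a
function of the noise up to time `r` (`natural_le_eventuallyMeasurableSpace`). So `A` is known to a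
σ-algebra which, for `W` and `N`, consists of the past of the process in question and of the two
other sources of randomness, and is independent of the increment (`indep_sup_past_increment`). For
the jumps, `A` is intersected with the event that the jump `i` happens after `r` and not after the
later time `s`; there the demand up to time `r` involves only the jump heights with an index below
`i`, of which the height of the jump `i` is independent (`IsDemandNoise.setIntegral_jump_of_indep`).

The convergence holds as a Poisson process almost surely does not jump at a given time `t`
(`IsPoissonProcess.ae_eventually_eq_left`): the demand is left-continuous there, and the last
update times tend to `t` from below.
-/

namespace PowerSupply

/-! ### Linear equations with integrable data -/

/-- Variation of constants for `f' = q - κ f`, where `q` is merely integrable: the equation is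
integrated against the integrating factor `exp (κ s)`, by parts for absolutely continuous
functions. -/
theorem eq_of_linear_integral_equation {κ a b c : ℝ} {q f : ℝ → ℝ} (hab : a ≤ b)
    (hq : IntervalIntegrable q volume a b) (hf : IntervalIntegrable f volume a b)
    (h : ∀ t ∈ Set.Icc a b, f t = c + ∫ s in a..t, (q s - κ * f s)) :
    f b = Real.exp (-κ * (b - a)) * c + ∫ s in a..b, Real.exp (-κ * (b - s)) * q s := by
  have hφ : IntervalIntegrable (fun s => q s - κ * f s) volume a b := hq.sub (hf.const_mul κ)
  set g : ℝ → ℝ := fun t => c + ∫ s in a..t, (q s - κ * f s) with hg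
  set E : ℝ → ℝ := fun t => Real.exp (κ * t) with hE
  have hEd : ∀ t, HasDerivAt E (κ * E t) t := fun t => by
    have := ((hasDerivAt_id t).const_mul κ).exp
    simpa [hE, mul_comm] using this
  have hEac : AbsolutelyContinuousOnInterval E a b := by
    refine ContDiffOn.absolutelyContinuousOnInterval (ContDiff.contDiffOn ?_)
    fun_prop
  have hgac : AbsolutelyContinuousOnInterval g a b := by
    have h0 : AbsolutelyContinuousOnInterval (fun _ : ℝ => c) a b :=
      ContDiffOn.absolutelyContinuousOnInterval contDiffOn_const
    exact h0.add (hφ.absolutelyContinuousOnInterval_intervalIntegral (c := a) (by simp))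
  have key := hEac.integral_deriv_mul_eq_sub hgac
  have hcongr : ∫ x in a..b, (deriv E x * g x + E x * deriv g x) = ∫ x in a..b, E x * q x := by
    refine intervalIntegral.integral_congr_ae ?_
    filter_upwards [hφ.ae_hasDerivAt_integral] with x hx hxab
    have hx' : x ∈ Set.uIcc a b := Set.uIoc_subset_uIcc hxab
    have hgd : HasDerivAt g (q x - κ * f x) x := (hx hx' a (by simp)).const_add c
    rw [(hEd x).deriv, hgd.deriv, h x (by rwa [Set.uIcc_of_le hab] at hx')]
    simp only [hg]
    ring
  have hga : g a = c := by simp [hg]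
  have hgb : g b = f b := (h b ⟨hab, le_rfl⟩).symm
  rw [hcongr, hga, hgb] at key
  have h1 : ∫ s in a..b, Real.exp (-κ * (b - s)) * q s
      = Real.exp (-κ * b) * ∫ s in a..b, E s * q s := by
    rw [← intervalIntegral.integral_const_mul]
    refine intervalIntegral.integral_congr fun s _ => ?_
    simp only [hE]
    rw [← mul_assoc, ← Real.exp_add]
    congr 2; ring
  have e1 : Real.exp (-κ * b) * E b = 1 := by
    rw [← Real.exp_add, show -κ * b + κ * b = 0 by ring, Real.exp_zero]
  have e2 : Real.exp (-κ * b) * E a = Real.exp (-κ * (b - a)) := by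
    rw [← Real.exp_add, show -κ * b + κ * a = -κ * (b - a) by ring]
  rw [h1, key]
  linear_combination (-f b) * e1 + c * e2

/-! ### Paths of the demand -/

/-- The path `y` solves `dy = κ (μ - y) dt + dx`, `y 0 = y₀ + x 0`, on `[0, T]`, in integrated
form. -/
def IsPathSolution (κ y₀ : ℝ) (μ : ℝ → ℝ) (T : ℝ≥0) (x y : ℝ≥0 → ℝ) : Prop :=
  IntervalIntegrable (fun s : ℝ => y s.toNNReal) volume 0 T ∧
    ∀ t : ℝ≥0, t ≤ T → y t = y₀ + (∫ s in (0 : ℝ)..t, κ * (μ s - y s.toNNReal)) + x t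

namespace IsPathSolution

variable {κ y₀ : ℝ} {μ : ℝ → ℝ} {T : ℝ≥0} {x y : ℝ≥0 → ℝ}

theorem mono (h : IsPathSolution κ y₀ μ T x y) {r : ℝ≥0} (hr : r ≤ T) :
    IsPathSolution κ y₀ μ r x y :=
  ⟨h.1.mono_set (Set.uIcc_subset_uIcc_left (by simp [hr])), fun t ht => h.2 t (ht.trans hr)⟩

theorem congr_driver (h : IsPathSolution κ y₀ μ T x y) {x' : ℝ≥0 → ℝ}
    (hx : ∀ t ≤ T, x' t = x t) : IsPathSolution κ y₀ μ T x' y :=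
  ⟨h.1, fun t ht => by rw [hx t ht]; exact h.2 t ht⟩

theorem intervalIntegrable_drift (h : IsPathSolution κ y₀ μ T x y)
    (hμ : IntervalIntegrable μ volume 0 T) :
    IntervalIntegrable (fun s => κ * (μ s - y s.toNNReal)) volume 0 T :=
  (hμ.sub h.1).const_mul κ

theorem continuousOn_drift_integral (h : IsPathSolution κ y₀ μ T x y)
    (hμ : IntervalIntegrable μ volume 0 T) :
    ContinuousOn (fun t : ℝ≥0 => ∫ s in (0 : ℝ)..t, κ * (μ s - y s.toNNReal)) (Set.Iic T) := by
  have h1 := intervalIntegral.continuousOn_primitive_interval'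
    (h.intervalIntegrable_drift hμ) (a := 0) (by simp)
  refine h1.comp (by fun_prop) fun t ht => ?_
  rw [Set.uIcc_of_le T.coe_nonneg]
  exact ⟨t.coe_nonneg, by exact_mod_cast ht⟩

theorem intervalIntegrable_driver (h : IsPathSolution κ y₀ μ T x y)
    (hμ : IntervalIntegrable μ volume 0 T) :
    IntervalIntegrable (fun s : ℝ => x s.toNNReal) volume 0 T := by
  have h1 := intervalIntegral.continuousOn_primitive_interval'
    (h.intervalIntegrable_drift hμ) (a := 0) (by simp)
  refine ((h.1.sub h1.intervalIntegrable).sub (intervalIntegrable_const (c := y₀))).congr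
    fun s hs => ?_
  rw [Set.uIoc_of_le T.coe_nonneg] at hs
  have h2 := h.2 s.toNNReal (Real.toNNReal_le_iff_le_coe.2 hs.2)
  rw [Real.coe_toNNReal s hs.1.le] at h2
  linarith

/-- The solution, without a stochastic integral: `y - x` solves an equation with the integrable
inhomogeneity `κ (μ - x)`. -/
theorem eq_explicit (h : IsPathSolution κ y₀ μ T x y) (hμ : IntervalIntegrable μ volume 0 T) :
    y T = Real.exp (-κ * T) * y₀
      + (∫ s in (0 : ℝ)..T, Real.exp (-κ * (T - s)) * (κ * (μ s - x s.toNNReal))) + x T := by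
  have hx := h.intervalIntegrable_driver hμ
  have key := eq_of_linear_integral_equation (κ := κ) (a := 0) (b := T) (c := y₀)
    (q := fun s => κ * (μ s - x s.toNNReal)) (f := fun s => y s.toNNReal - x s.toNNReal)
    T.coe_nonneg ((hμ.sub hx).const_mul κ) (h.1.sub hx) (fun t ht => by
      have h2 := h.2 t.toNNReal (Real.toNNReal_le_iff_le_coe.2 ht.2)
      rw [Real.coe_toNNReal t ht.1] at h2
      rw [h2]
      have : ∀ s, κ * (μ s - x s.toNNReal) - κ * (y s.toNNReal - x s.toNNReal)
          = κ * (μ s - y s.toNNReal) := fun s => by ring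
      simp_rw [this]
      ring)
  simp only [Real.toNNReal_coe, sub_zero] at key
  linarith

theorem continuousWithinAt (h : IsPathSolution κ y₀ μ T x y)
    (hμ : IntervalIntegrable μ volume 0 T) {t : ℝ≥0} (ht : t ≤ T) {S : Set ℝ≥0}
    (hS : S ⊆ Set.Iic T) (hx : ContinuousWithinAt x S t) : ContinuousWithinAt y S t := by
  have h1 := ((h.continuousOn_drift_integral hμ) t ht).mono hS
  refine ((continuousWithinAt_const (b := y₀)).add h1 |>.add hx).congr (fun s hs => ?_) ?_
  · exact h.2 s (hS hs)
  · exact h.2 t ht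

theorem abs_le (hκ : 0 ≤ κ) (h : IsPathSolution κ y₀ μ T x y)
    (hμ : IntervalIntegrable μ volume 0 T) {t : ℝ≥0} (ht : t ≤ T) :
    |y t| ≤ |y₀| + κ * (∫ s in (0 : ℝ)..T, |μ s|) + κ * (∫ s in (0 : ℝ)..T, |x s.toNNReal|)
      + |x t| := by
  have htT : (t : ℝ) ≤ T := by exact_mod_cast ht
  have hμt : IntervalIntegrable μ volume 0 t :=
    hμ.mono_set (Set.uIcc_subset_uIcc_left (by simp [ht]))
  have hx := h.intervalIntegrable_driver hμ
  have hxt := (h.mono ht).intervalIntegrable_driver hμt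
  rw [(h.mono ht).eq_explicit hμt]
  have hexp : ∀ s : ℝ, s ≤ t → Real.exp (-κ * (t - s)) ≤ 1 := fun s hs => by
    rw [Real.exp_le_one_iff]; nlinarith
  have h0 : |Real.exp (-κ * t) * y₀| ≤ |y₀| := by
    rw [abs_mul, abs_of_pos (Real.exp_pos _)]
    have := hexp 0 t.coe_nonneg
    rw [sub_zero] at this
    exact mul_le_of_le_one_left (abs_nonneg _) this
  have h1 : |∫ s in (0 : ℝ)..t, Real.exp (-κ * (t - s)) * (κ * (μ s - x s.toNNReal))|
      ≤ ∫ s in (0 : ℝ)..t, (κ * |μ s| + κ * |x s.toNNReal|) := by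
    rw [← Real.norm_eq_abs]
    refine intervalIntegral.norm_integral_le_of_norm_le t.coe_nonneg (ae_of_all _ fun s hs => ?_)
      ((hμt.abs.const_mul κ).add (hxt.abs.const_mul κ))
    rw [Real.norm_eq_abs, abs_mul, abs_mul, abs_of_pos (Real.exp_pos _), abs_of_nonneg hκ,
      ← mul_add]
    refine (mul_le_of_le_one_left (by positivity) (hexp s hs.2)).trans ?_
    exact mul_le_mul_of_nonneg_left (abs_sub _ _) hκ
  have h2 : ∫ s in (0 : ℝ)..t, (κ * |μ s| + κ * |x s.toNNReal|)
      ≤ ∫ s in (0 : ℝ)..T, (κ * |μ s| + κ * |x s.toNNReal|) := by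
    refine intervalIntegral.integral_mono_interval le_rfl t.coe_nonneg htT
      (ae_of_all _ fun s => by positivity) ((hμ.abs.const_mul κ).add (hx.abs.const_mul κ))
  rw [intervalIntegral.integral_add (hμ.abs.const_mul κ) (hx.abs.const_mul κ),
    intervalIntegral.integral_const_mul, intervalIntegral.integral_const_mul] at h2
  refine (abs_add_three _ _ _).trans ?_
  linarith

end IsPathSolution

/-! ### Joint measurability of right-continuous processes -/

/-- The least time of the form `k / (n + 1)` that is later than `s`, cut off at `r`. -/
noncomputable def gridAfter (r : ℝ≥0) (n : ℕ) (s : ℝ≥0) : ℝ≥0 :=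
  min ((⌊s * (n + 1)⌋₊ + 1 : ℝ≥0) / (n + 1)) r

theorem le_gridAfter {r : ℝ≥0} (n : ℕ) {s : ℝ≥0} (hs : s ≤ r) : s ≤ gridAfter r n s := by
  refine le_min ?_ hs
  rw [le_div_iff₀ (by positivity)]
  exact (Nat.lt_floor_add_one _).le

theorem gridAfter_le (r : ℝ≥0) (n : ℕ) (s : ℝ≥0) : gridAfter r n s ≤ r := min_le_right _ _

theorem tendsto_gridAfter {r s : ℝ≥0} (hs : s ≤ r) :
    Tendsto (fun n => gridAfter r n s) atTop (𝓝[≥] s) := by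
  refine tendsto_nhdsWithin_iff.2 ⟨?_, Eventually.of_forall fun n => le_gridAfter n hs⟩
  have h1 : Tendsto (fun n : ℕ => s + 1 / ((n : ℝ≥0) + 1)) atTop (𝓝 (s + 0)) :=
    tendsto_const_nhds.add tendsto_one_div_add_atTop_nhds_zero_nat
  rw [add_zero] at h1
  refine tendsto_of_tendsto_of_tendsto_of_le_of_le tendsto_const_nhds h1
    (fun n => le_gridAfter n hs) fun n => (min_le_left _ _).trans ?_
  rw [add_div]
  gcongr
  rw [div_le_iff₀ (by positivity)]
  exact Nat.floor_le (by positivity)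

variable {Ω : Type*}

theorem measurable_comp_of_countable [MeasurableSpace Ω] {X : ℝ≥0 → Ω → ℝ} {φ : ℕ → ℝ≥0}
    {f : ℝ≥0 → ℕ} (hX : ∀ k, Measurable (X (φ k))) (hf : Measurable f) :
    Measurable (fun p : ℝ≥0 × Ω => X (φ (f p.1)) p.2) := by
  have h1 : Measurable (fun p : ℕ × Ω => X (φ p.1) p.2) :=
    measurable_from_prod_countable_right hX
  exact h1.comp ((hf.comp measurable_fst).prodMk measurable_snd)

theorem measurable_comp_gridAfter [MeasurableSpace Ω] {X : ℝ≥0 → Ω → ℝ} {r : ℝ≥0}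
    (hX : ∀ t ≤ r, Measurable (X t)) (n : ℕ) :
    Measurable (fun p : ℝ≥0 × Ω => X (gridAfter r n p.1) p.2) := by
  refine measurable_comp_of_countable (φ := fun k : ℕ => min ((k + 1 : ℝ≥0) / (n + 1)) r)
    (f := fun s : ℝ≥0 => ⌊s * (n + 1)⌋₊) (fun k => hX _ (min_le_right _ _)) (by fun_prop)

/-- A process has a version on `[0, r]` that is jointly measurable and agrees with it along every
path that is right-continuous on `[0, r)`. -/
theorem exists_measurable_version [MeasurableSpace Ω] {X : ℝ≥0 → Ω → ℝ} {r : ℝ≥0}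
    (hX : ∀ t ≤ r, Measurable (X t)) :
    ∃ Z : ℝ≥0 × Ω → ℝ, Measurable Z ∧ ∀ ω,
      (∀ s < r, ContinuousWithinAt (X · ω) (Set.Ici s) s) → ∀ s ≤ r, Z (s, ω) = X s ω := by
  refine ⟨fun p => limUnder atTop fun n => X (gridAfter r n p.1) p.2,
    (StronglyMeasurable.limUnder fun n =>
      (measurable_comp_gridAfter hX n).stronglyMeasurable).measurable, fun ω hω s hs => ?_⟩
  refine Tendsto.limUnder_eq ?_
  rcases hs.lt_or_eq with h | rfl
  · exact (hω s h).tendsto.comp (tendsto_gridAfter hs)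
  · have : ∀ n, gridAfter s n s = s := fun n =>
      le_antisymm (gridAfter_le _ _ _) (le_gridAfter n le_rfl)
    simp only [this]
    exact tendsto_const_nhds

/-- The integral in `IsPathSolution.eq_explicit` is measurable with respect to any σ-algebra for
which the driver `X` is measurable up to time `t`; there `w` need not be Borel measurable. -/
theorem exists_measurable_eq_integral [MeasurableSpace Ω] {X : ℝ≥0 → Ω → ℝ} {t : ℝ≥0}
    (hX : ∀ u ≤ t, Measurable (X u)) {v w : ℝ → ℝ} (hv : Measurable v)
    (hw : IntervalIntegrable w volume 0 t) :
    ∃ G : Ω → ℝ, Measurable G ∧ ∀ ω, (∀ s < t, ContinuousWithinAt (X · ω) (Set.Ici s) s) →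
      G ω = ∫ s in (0 : ℝ)..t, v s * (w s - X s.toNNReal ω) := by
  obtain ⟨Z, hZ, hZX⟩ := exists_measurable_version hX
  have hwm := hw.aestronglyMeasurable
  have hw' : Measurable (hwm.mk w) := hwm.stronglyMeasurable_mk.measurable
  have hF : StronglyMeasurable fun p : Ω × ℝ => v p.2 * (hwm.mk w p.2 - Z (p.2.toNNReal, p.1)) := by
    refine Measurable.stronglyMeasurable ?_
    fun_prop
  refine ⟨fun ω => ∫ s in Set.Ioc (0 : ℝ) t, v s * (hwm.mk w s - Z (s.toNNReal, ω)),
    hF.integral_prod_right.measurable, fun ω hω => ?_⟩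
  simp only
  rw [intervalIntegral.integral_of_le t.coe_nonneg]
  refine integral_congr_ae ?_
  filter_upwards [hwm.ae_eq_mk, ae_restrict_mem measurableSet_Ioc] with s h1 h2
  rw [h1, hZX ω hω s.toNNReal (Real.toNNReal_le_iff_le_coe.2 h2.2)]

/-- If the driver is known to `K` up to time `r`, then so is the demand, up to null sets. The
measure `Q` may be a restriction, so that the equation is needed only on an event. -/
theorem natural_le_eventuallyMeasurableSpace {K mΩ : MeasurableSpace Ω} {κ y₀ : ℝ} {μ : ℝ → ℝ}
    {r : ℝ≥0} (hμ : IntervalIntegrable μ volume 0 r) {X Y : ℝ≥0 → Ω → ℝ}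
    (hYm : ∀ t, StronglyMeasurable (Y t)) {Q : Measure Ω}
    (hX : ∀ u ≤ r, Measurable[K] (X u))
    (hrc : ∀ᵐ ω ∂Q, ∀ s < r, ContinuousWithinAt (X · ω) (Set.Ici s) s)
    (hsol : ∀ᵐ ω ∂Q, IsPathSolution κ y₀ μ r (X · ω) (Y · ω)) :
    Filtration.natural Y hYm r ≤ eventuallyMeasurableSpace K (ae Q) := by
  refine iSup₂_le fun t ht => ?_
  rw [← measurable_iff_comap_le]
  have hμt : IntervalIntegrable μ volume 0 t :=
    hμ.mono_set (Set.uIcc_subset_uIcc_left (by simp [ht]))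
  obtain ⟨G, hG, hGX⟩ := @exists_measurable_eq_integral Ω K X t (fun u hu => hX u (hu.trans ht))
    (fun s => Real.exp (-κ * (t - s)) * κ) μ (by fun_prop) hμt
  have hm : Measurable[K] fun ω => Real.exp (-κ * t) * y₀ + G ω + X t ω :=
    (measurable_const.add hG).add (hX t ht)
  refine hm.eventuallyMeasurable_of_eventuallyEq ?_
  filter_upwards [hrc, hsol] with ω h1 h2
  rw [(h2.mono ht).eq_explicit hμt, hGX ω fun s hs => h1 s (hs.trans_le ht)]
  simp only [mul_assoc]

/-! ### Independence of the future increments from the past -/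

section Independence

variable {Ω : Type*} [mΩ : MeasurableSpace Ω] {P : Measure Ω}

theorem indep_sup_left_of_indep_sup_right [IsProbabilityMeasure P] {m₁ m₂ m₃ : MeasurableSpace Ω}
    (hm₁ : m₁ ≤ mΩ) (hm₂ : m₂ ≤ mΩ) (hm₃ : m₃ ≤ mΩ) (h : Indep m₁ (m₂ ⊔ m₃) P)
    (h₂₃ : Indep m₂ m₃ P) : Indep (m₁ ⊔ m₂) m₃ P := by
  set p : Set (Set Ω) := {s | ∃ A B, MeasurableSet[m₁] A ∧ MeasurableSet[m₂] B ∧ A ∩ B = s}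
  have hp : IsPiSystem p := by
    rintro _ ⟨A, B, hA, hB, rfl⟩ _ ⟨A', B', hA', hB', rfl⟩ -
    exact ⟨A ∩ A', B ∩ B', hA.inter hA', hB.inter hB', Set.inter_inter_inter_comm _ _ _ _⟩
  have hgen : m₁ ⊔ m₂ = MeasurableSpace.generateFrom p := by
    refine le_antisymm (sup_le (fun A hA => ?_) fun B hB => ?_) ?_
    · exact MeasurableSpace.measurableSet_generateFrom
        ⟨A, Set.univ, hA, MeasurableSet.univ, Set.inter_univ _⟩
    · exact MeasurableSpace.measurableSet_generateFrom
        ⟨Set.univ, B, MeasurableSet.univ, hB, Set.univ_inter _⟩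
    · refine MeasurableSpace.generateFrom_le ?_
      rintro _ ⟨A, B, hA, hB, rfl⟩
      exact MeasurableSet.inter (m := m₁ ⊔ m₂) ((le_sup_left : m₁ ≤ m₁ ⊔ m₂) _ hA)
        ((le_sup_right : m₂ ≤ m₁ ⊔ m₂) _ hB)
  refine IndepSets.indep (sup_le hm₁ hm₂) hm₃ hp (@MeasurableSpace.isPiSystem_measurableSet _ m₃)
    hgen (@MeasurableSpace.generateFrom_measurableSet _ m₃).symm ?_
  rw [IndepSets_iff]
  rintro _ C ⟨A, B, hA, hB, rfl⟩ hC
  rw [Indep_iff] at h h₂₃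
  have hB' : MeasurableSet[m₂ ⊔ m₃] B := (le_sup_left : m₂ ≤ m₂ ⊔ m₃) _ hB
  have hC' : MeasurableSet[m₂ ⊔ m₃] C := (le_sup_right : m₃ ≤ m₂ ⊔ m₃) _ hC
  rw [Set.inter_assoc, h A _ hA (MeasurableSet.inter (m := m₂ ⊔ m₃) hB' hC'), h A B hA hB',
    h₂₃ B C hB hC, mul_assoc]

/-- Finitely many times up to `r`, together with `0`, `r` and a later time `s`, are listed by a
monotone sequence. -/
theorem exists_monotone_through (J : Finset ℝ≥0) :
    ∀ r s : ℝ≥0, r ≤ s → (∀ u ∈ J, u ≤ r) → ∃ (t : ℕ → ℝ≥0) (n : ℕ), Monotone t ∧ t 0 = 0 ∧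
      t n = r ∧ t (n + 1) = s ∧ ∀ u ∈ J, ∃ k ≤ n, t k = u := by
  refine Finset.induction_on_max J ?_ fun a J hJ ih => ?_
  · intro r s hrs _
    refine ⟨fun k => if k = 0 then 0 else if k = 1 then r else s, 1, ?_, ?_⟩
    · refine monotone_nat_of_le_succ fun k => ?_
      rcases k with _ | _ | k <;> simp [hrs]
    · simp
  · intro r s hrs hr
    obtain ⟨t, n, ht, h0, hn, hn', hJt⟩ := ih a r (hr a (by simp)) fun u hu => (hJ u hu).le
    refine ⟨fun k => if k ≤ n + 1 then t k else s, n + 1, ?_, by simp [h0], by simp [hn'],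
      by simp, fun u hu => ?_⟩
    · refine monotone_nat_of_le_succ fun k => ?_
      by_cases h1 : k + 1 ≤ n + 1
      · simp only [h1, if_true, show k ≤ n + 1 by omega]
        exact ht (Nat.le_succ k)
      · by_cases h2 : k ≤ n + 1
        · have : k = n + 1 := by omega
          simp [this, hn', hrs]
        · simp [h1, h2]
    · rcases Finset.mem_insert.1 hu with rfl | hu
      · exact ⟨n, by omega, by simp [hn]⟩
      · obtain ⟨k, hk, rfl⟩ := hJt u hu
        exact ⟨k, by omega, by simp [show k ≤ n + 1 by omega]⟩

/-- For a process that starts at `0` and has independent increments, an increment after time `r`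
is independent of the path up to time `r`. -/
theorem indep_past_increment [IsProbabilityMeasure P] {X : ℝ≥0 → Ω → ℝ}
    (hX : ∀ t, Measurable (X t)) (h0 : ∀ᵐ ω ∂P, X 0 ω = 0) (hi : HasIndepIncrements X P)
    {r s : ℝ≥0} (hrs : r ≤ s) :
    IndepFun (fun ω (u : Set.Iic r) => X u ω) (X s - X r) P := by
  refine IndepFun.process_indepFun (X := fun (u : Set.Iic r) ω => X u ω) (fun u => hX u)
    ((hX s).sub (hX r)) fun I => ?_
  obtain ⟨t, n, ht, ht0, htn, htn', hI⟩ := exists_monotone_through (I.image Subtype.val) r s hrs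
    (by rintro _ hu; obtain ⟨u, -, rfl⟩ := Finset.mem_image.1 hu; exact u.2)
  have hI' : ∀ i : I, ∃ k ≤ n, t k = i := fun i => hI i (Finset.mem_image_of_mem _ i.2)
  choose k hk hkt using hI'
  have hind := (hi.nat ht).indepFun_finset (Finset.range n) {n} (by simp)
    (fun i => (hX _).sub (hX _))
  have hψ : Measurable fun v : ({n} : Finset ℕ) → ℝ => v ⟨n, by simp⟩ := measurable_pi_apply _
  have := hind.comp
    (φ := fun v (i : I) => ∑ j : Finset.range n, if (j : ℕ) < k i then v j else 0)
    (ψ := fun v => v ⟨n, by simp⟩)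
    (measurable_pi_lambda _ fun i => Finset.measurable_sum _ fun j _ => by
      split_ifs
      · exact measurable_pi_apply j
      · exact measurable_const)
    hψ
  refine this.congr ?_ (ae_of_all _ fun ω => by simp [htn, htn'])
  filter_upwards [h0] with ω hω
  funext i
  simp only [Function.comp]
  rw [Finset.sum_coe_sort (Finset.range n)
    (fun j => if j < k i then X (t (j + 1)) ω - X (t j) ω else 0), ← Finset.sum_filter]
  have : (Finset.range n).filter (fun j => j < k i) = Finset.range (k i) := by
    ext j
    have := hk i
    simp only [Finset.mem_filter, Finset.mem_range]
    omega
  rw [this, Finset.sum_range_sub (fun j => X (t j) ω), ht0, hω, sub_zero, hkt]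

end Independence

/-! ### Moments of the Poisson distribution -/

theorem integrable_natCast_sq_poissonMeasure (r : ℝ≥0) :
    Integrable (fun n : ℕ => (n : ℝ) ^ 2) (poissonMeasure r) := by
  rw [integrable_poissonMeasure_iff]
  refine Summable.of_nonneg_of_le (fun n => by positivity) (fun n => ?_)
    ((Real.summable_pow_div_factorial (4 * r)).mul_left (Real.exp (-r)))
  have : (n : ℝ) ^ 2 ≤ 4 ^ n := by
    have : (n : ℝ) ≤ 2 ^ n := by exact_mod_cast Nat.lt_two_pow_self.le
    calc (n : ℝ) ^ 2 ≤ (2 ^ n) ^ 2 := by gcongr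
      _ = 4 ^ n := by rw [← pow_mul, mul_comm, pow_mul]; norm_num
  rw [norm_pow, Real.norm_natCast, mul_pow]
  calc Real.exp (-r) * r ^ n / n.factorial * (n : ℝ) ^ 2
      ≤ Real.exp (-r) * r ^ n / n.factorial * 4 ^ n := by gcongr
    _ = _ := by ring

theorem integrable_natCast_poissonMeasure (r : ℝ≥0) :
    Integrable (fun n : ℕ => (n : ℝ)) (poissonMeasure r) := by
  refine (integrable_natCast_sq_poissonMeasure r).mono' (by fun_prop) (ae_of_all _ fun n => ?_)
  rw [Real.norm_natCast]
  exact_mod_cast Nat.le_self_pow two_ne_zero n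

theorem integral_natCast_poissonMeasure (r : ℝ≥0) :
    ∫ n : ℕ, (n : ℝ) ∂poissonMeasure r = r := by
  have h := hasSum_integral_poissonMeasure (integrable_natCast_poissonMeasure r)
  refine h.unique ?_
  rw [← hasSum_nat_add_iff' 1]
  have h1 := (hasSum_one_poissonMeasure r).mul_left (r : ℝ)
  simp only [Finset.range_one, Finset.sum_singleton, Nat.cast_zero, smul_zero, sub_zero]
  rw [mul_one] at h1
  refine h1.congr_fun fun n => ?_
  rw [Nat.factorial_succ]
  push_cast
  rw [smul_eq_mul]
  field_simp
  ring

/-! ### The driving noise and its moments -/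

theorem memLp_two_of_lintegral_ne_top {α : Type*} [MeasurableSpace α] {Q : Measure α} {f : α → ℝ}
    (hf : AEStronglyMeasurable f Q) (h : ∫⁻ a, ENNReal.ofReal (f a ^ 2) ∂Q ≠ ∞) :
    MemLp f 2 Q := by
  rw [memLp_two_iff_integrable_sq hf]
  refine ⟨hf.pow 2, ?_⟩
  rw [hasFiniteIntegral_iff_ofReal (ae_of_all _ fun ω => sq_nonneg _)]
  exact h.lt_top

theorem lintegral_ofReal_sq_ne_top {α : Type*} [MeasurableSpace α] {Q : Measure α} {f : α → ℝ}
    (hf : MemLp f 2 Q) : ∫⁻ a, ENNReal.ofReal (f a ^ 2) ∂Q ≠ ∞ := by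
  have := hf.integrable_sq.2
  rw [hasFiniteIntegral_iff_ofReal (ae_of_all _ fun ω => sq_nonneg _)] at this
  exact this.ne

theorem ofReal_add_sq_le (a b : ℝ) :
    ENNReal.ofReal ((a + b) ^ 2) ≤ 2 * ENNReal.ofReal (a ^ 2) + 2 * ENNReal.ofReal (b ^ 2) := by
  rw [← ENNReal.ofReal_ofNat, ← ENNReal.ofReal_mul zero_le_two, ← ENNReal.ofReal_mul zero_le_two,
    ← ENNReal.ofReal_add (by positivity) (by positivity)]
  exact ENNReal.ofReal_le_ofReal (by nlinarith [sq_nonneg (a - b)])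

section Noise

variable {Ω : Type*} [MeasurableSpace Ω] {P : Measure Ω}

theorem measurable_sum_range_comp {M : Ω → ℕ} (hM : Measurable M) {g : ℕ → Ω → ℝ}
    (hg : ∀ i, Measurable (g i)) : Measurable fun ω => ∑ i ∈ Finset.range (M ω), g i ω := by
  have h1 : Measurable (fun p : ℕ × Ω => ∑ i ∈ Finset.range p.1, g i p.2) :=
    measurable_from_prod_countable_right fun k =>
      Finset.measurable_sum (Finset.range k) fun i _ => hg i
  exact h1.comp (hM.prodMk measurable_id)

section Poisson

variable {N : ℝ≥0 → Ω → ℕ} {ν : ℝ≥0}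

theorem IsPoissonProcess.hasLaw_eval (hN : IsPoissonProcess N ν P) (t : ℝ≥0) :
    HasLaw (N t) (poissonMeasure (ν * t)) P := by
  have h := hN.law 0 t zero_le
  rw [tsub_zero] at h
  refine h.congr ?_
  filter_upwards [hN.zero] with ω hω
  simp [hω]

theorem IsPoissonProcess.memLp (hN : IsPoissonProcess N ν P) (t : ℝ≥0) :
    MemLp (fun ω => (N t ω : ℝ)) 2 P := by
  have hm : Measurable fun ω => (N t ω : ℝ) := measurable_from_nat.comp (hN.measurable t)
  rw [memLp_two_iff_integrable_sq hm.aestronglyMeasurable]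
  have h := integrable_natCast_sq_poissonMeasure (ν * t)
  rw [← (hN.hasLaw_eval t).map_eq,
    integrable_map_measure (by fun_prop) (hN.measurable t).aemeasurable] at h
  exact h

theorem IsPoissonProcess.integral_eval (hN : IsPoissonProcess N ν P) (t : ℝ≥0) :
    ∫ ω, (N t ω : ℝ) ∂P = ν * t := by
  have h := (hN.hasLaw_eval t).integral_comp (f := fun n : ℕ => (n : ℝ)) (by fun_prop)
  rw [integral_natCast_poissonMeasure] at h
  exact_mod_cast h

/-- A Poisson process almost surely does not jump at a given time. -/
theorem IsPoissonProcess.ae_eventually_eq_left [IsProbabilityMeasure P]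
    (hN : IsPoissonProcess N ν P) (t : ℝ≥0) :
    ∀ᵐ ω ∂P, ∀ᶠ s in 𝓝[≤] t, N s ω = N t ω := by
  set s : ℕ → ℝ≥0 := fun n => t - 1 / (n + 1) with hs
  -- a jump between `s n` and `t` has a probability of at most `ν (t - s n)`
  have hreal : ∀ n, P.real {ω | N t ω - N (s n) ω ≠ 0} ≤ ν * (1 / ((n : ℝ) + 1)) := by
    intro n
    have h1 := (hN.law (s n) t tsub_le_self).measureReal_eq (p := fun k => k ≠ 0)
      (MeasurableSet.of_discrete)
    rw [h1]
    have h2 : {k : ℕ | k ≠ 0} = {0}ᶜ := by ext; simp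
    rw [h2, probReal_compl_eq_one_sub (MeasurableSet.of_discrete), poissonMeasure_real_singleton]
    have h3 : ((ν * (t - s n) : ℝ≥0) : ℝ) ≤ ν * (1 / ((n : ℝ) + 1)) := by
      have : ν * (t - s n) ≤ ν * (1 / (n + 1)) := by
        gcongr
        exact tsub_tsub_le
      exact_mod_cast this
    have h4 := Real.add_one_le_exp (-((ν * (t - s n) : ℝ≥0) : ℝ))
    simp only [pow_zero, mul_one, Nat.factorial_zero, Nat.cast_one, div_one]
    linarith
  have hB : P {ω | ∀ n, N t ω - N (s n) ω ≠ 0} = 0 := by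
    rw [← measureReal_eq_zero_iff]
    refine le_antisymm (ge_of_tendsto' (x := atTop) ?_ fun n =>
      (measureReal_mono (fun ω (hω : ∀ n, N t ω - N (s n) ω ≠ 0) => hω n)).trans (hreal n))
      measureReal_nonneg
    simpa using (tendsto_one_div_add_atTop_nhds_zero_nat (𝕜 := ℝ)).const_mul (ν : ℝ)
  have hB' : ∀ᵐ ω ∂P, ∃ n, N t ω - N (s n) ω = 0 := by
    rw [ae_iff]
    simpa using hB
  filter_upwards [hB', hN.mono] with ω ⟨n, hn⟩ hmono
  have hev : ∀ᶠ u in 𝓝[≤] t, s n ≤ u := by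
    rcases eq_or_ne t 0 with rfl | ht
    · exact Eventually.of_forall fun u => by simp [hs]
    · refine nhdsWithin_le_nhds ((lt_mem_nhds ?_).mono fun u hu => hu.le)
      exact tsub_lt_self (pos_of_ne_zero ht) (by positivity)
  filter_upwards [hev, self_mem_nhdsWithin] with u hu hut
  have h1 := hmono hu
  have h2 := hmono (show u ≤ t from hut)
  simp only at h1 h2
  omega

end Poisson

/-- The standing assumptions on the sources of randomness: a Brownian motion, a Poisson process
of intensity `ν` and i.i.d. jump heights with a square integrable law `ρ`, all independent. -/
structure IsDemandNoise (ν : ℝ≥0) (ρ : Measure ℝ) (W : ℝ≥0 → Ω → ℝ) (N : ℝ≥0 → Ω → ℕ)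
    (γ : ℕ → Ω → ℝ) (P : Measure Ω) : Prop where
  measurable_brownian : ∀ t, Measurable (W t)
  brownian : IsBrownianReal W P
  poisson : IsPoissonProcess N ν P
  memLp_law : MemLp id 2 ρ
  measurable_jump : ∀ i, Measurable (γ i)
  hasLaw_jump : ∀ i, HasLaw (γ i) ρ P
  iIndepFun_jump : iIndepFun γ P
  indepFun_brownian_poisson : IndepFun (fun ω t => W t ω) (fun ω t => N t ω) P
  indepFun_jump : IndepFun (fun ω i => γ i ω) (fun ω => ((fun t => W t ω), (fun t => N t ω))) P

/-- The noise `σ W_t + ∑_{i < N_t} γ_i` that drives the demand. -/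
def noise (σ : ℝ) (W : ℝ≥0 → Ω → ℝ) (N : ℝ≥0 → Ω → ℕ) (γ : ℕ → Ω → ℝ) (t : ℝ≥0) (ω : Ω) : ℝ :=
  σ * W t ω + ∑ i ∈ Finset.range (N t ω), γ i ω

variable {σ : ℝ} {ν : ℝ≥0} {ρ : Measure ℝ} {W : ℝ≥0 → Ω → ℝ} {N : ℝ≥0 → Ω → ℕ} {γ : ℕ → Ω → ℝ}

theorem measurable_noise {t : ℝ≥0} (hW : Measurable (W t)) (hN : Measurable (N t))
    (hγ : ∀ i, Measurable (γ i)) : Measurable (noise σ W N γ t) :=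
  (hW.const_mul σ).add (measurable_sum_range_comp hN hγ)

namespace IsDemandNoise

theorem isProbabilityMeasure_law [IsProbabilityMeasure P] (h : IsDemandNoise ν ρ W N γ P) :
    IsProbabilityMeasure ρ :=
  (h.hasLaw_jump 0).isProbabilityMeasure_iff.1 inferInstance

/-- The sum of the absolute values of the jumps (or of functions of the jumps) up to time `t` is
square integrable: by the Cauchy-Schwarz inequality its square is at most
`N_t ∑_{i < N_t} (f γ_i)²`, whose mean is `𝔼[N_t²] 𝔼[(f γ_0)²]`, as the jump heights are
independent of `N`. -/
theorem memLp_sum_abs_jump [IsProbabilityMeasure P] (h : IsDemandNoise ν ρ W N γ P) {f : ℝ → ℝ}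
    (hf : Measurable f) (hfρ : MemLp f 2 ρ) (t : ℝ≥0) :
    MemLp (fun ω => ∑ i ∈ Finset.range (N t ω), |f (γ i ω)|) 2 P := by
  have hm : Measurable fun ω => ∑ i ∈ Finset.range (N t ω), |f (γ i ω)| :=
    measurable_sum_range_comp (h.poisson.measurable t)
      fun i => continuous_abs.measurable.comp (hf.comp (h.measurable_jump i))
  refine memLp_two_of_lintegral_ne_top hm.aestronglyMeasurable (ne_of_lt ?_)
  set c : ℝ≥0∞ := ∫⁻ x, ENNReal.ofReal (f x ^ 2) ∂ρ
  have hc : c ≠ ∞ := lintegral_ofReal_sq_ne_top hfρ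
  have hN2 : ∫⁻ ω, (N t ω : ℝ≥0∞) * N t ω ∂P ≠ ∞ := by
    refine ne_of_eq_of_ne (lintegral_congr fun ω => ?_)
      (lintegral_ofReal_sq_ne_top (h.poisson.memLp t))
    rw [ENNReal.ofReal_pow (by positivity), ENNReal.ofReal_natCast, sq]
  -- the weights that write `n ∑_{i < n} g i` as a series over all `i`
  set k : ℕ → ℕ → ℝ≥0∞ := fun i n => if i < n then (n : ℝ≥0∞) else 0 with hk
  have hNm := h.poisson.measurable t
  have hkm : ∀ i, Measurable fun ω => k i (N t ω) := fun i =>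
    (measurable_from_nat (f := k i)).comp hNm
  have hgm : ∀ i, Measurable fun ω => ENNReal.ofReal (f (γ i ω) ^ 2) := fun i =>
    ((hf.comp (h.measurable_jump i)).pow_const 2).ennreal_ofReal
  have hsum : ∀ n : ℕ, ∀ g : ℕ → ℝ≥0∞, ∑' i, k i n * g i = n * ∑ i ∈ Finset.range n, g i := by
    intro n g
    rw [tsum_eq_sum (s := Finset.range n) (fun i hi => by
      simp only [Finset.mem_range] at hi
      simp [hk, hi]), Finset.mul_sum]
    refine Finset.sum_congr rfl fun i hi => ?_
    simp [hk, Finset.mem_range.1 hi]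
  have hind : ∀ i, ∫⁻ ω, k i (N t ω) * ENNReal.ofReal (f (γ i ω) ^ 2) ∂P
      = (∫⁻ ω, k i (N t ω) ∂P) * c := by
    intro i
    have hi : IndepFun (fun ω => k i (N t ω)) (fun ω => ENNReal.ofReal (f (γ i ω) ^ 2)) P := by
      refine (h.indepFun_jump.comp (φ := fun v => ENNReal.ofReal (f (v i) ^ 2))
        (ψ := fun p => k i (p.2 t)) ?_ ?_).symm
      · exact ((hf.comp (measurable_pi_apply i)).pow_const 2).ennreal_ofReal
      · have ht : Measurable fun p : (ℝ≥0 → ℝ) × (ℝ≥0 → ℕ) => p.2 t := by fun_prop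
        exact (measurable_from_nat (f := k i)).comp ht
    rw [lintegral_mul_eq_lintegral_mul_lintegral_of_indepFun'' (hkm i).aemeasurable
      (hgm i).aemeasurable hi]
    congr 1
    exact (h.hasLaw_jump i).lintegral_comp (f := fun x => ENNReal.ofReal (f x ^ 2))
      (by fun_prop)
  calc ∫⁻ ω, ENNReal.ofReal ((∑ i ∈ Finset.range (N t ω), |f (γ i ω)|) ^ 2) ∂P
      ≤ ∫⁻ ω, ∑' i, k i (N t ω) * ENNReal.ofReal (f (γ i ω) ^ 2) ∂P := by
        refine lintegral_mono fun ω => ?_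
        rw [hsum, ← ENNReal.ofReal_sum_of_nonneg fun i _ => sq_nonneg _,
          ← ENNReal.ofReal_natCast, ← ENNReal.ofReal_mul (by positivity)]
        refine ENNReal.ofReal_le_ofReal ?_
        have := sq_sum_le_card_mul_sum_sq (s := Finset.range (N t ω)) (f := fun i => |f (γ i ω)|)
        simpa using this
    _ = ∑' i, (∫⁻ ω, k i (N t ω) ∂P) * c := by
        have hkg : ∀ i, Measurable fun ω => k i (N t ω) * ENNReal.ofReal (f (γ i ω) ^ 2) :=
          fun i => (hkm i).mul (hgm i)
        rw [lintegral_tsum fun i => (hkg i).aemeasurable]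
        simp_rw [hind]
    _ = (∫⁻ ω, (N t ω : ℝ≥0∞) * N t ω ∂P) * c := by
        rw [ENNReal.tsum_mul_right, ← lintegral_tsum fun i => (hkm i).aemeasurable]
        congr 1
        refine lintegral_congr fun ω => ?_
        have := hsum (N t ω) 1
        simpa using this
    _ < ∞ := ENNReal.mul_lt_top hN2.lt_top hc.lt_top

theorem memLp_brownian (h : IsDemandNoise ν ρ W N γ P) (t : ℝ≥0) : MemLp (W t) 2 P :=
  ((IsPreBrownianReal.isGaussianProcess h.brownian.toIsPreBrownianReal).hasGaussianLaw_eval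
    t).memLp_two

theorem lintegral_brownian_sq (h : IsDemandNoise ν ρ W N γ P) (t : ℝ≥0) :
    ∫⁻ ω, ENNReal.ofReal (W t ω ^ 2) ∂P = t := by
  have h1 := h.brownian.covariance_eval t t
  have h2 := h.memLp_brownian t
  rw [covariance_self (h.measurable_brownian t).aemeasurable,
    variance_of_integral_eq_zero (h.measurable_brownian t).aemeasurable
      (h.brownian.integral_eval t), min_self] at h1
  rw [← ofReal_integral_eq_lintegral_ofReal h2.integrable_sq (ae_of_all _ fun ω => sq_nonneg _)]
  rw [show ∫ ω, W t ω ^ 2 ∂P = t from h1, ENNReal.ofReal_coe_nnreal]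

theorem memLp_noise [IsProbabilityMeasure P] (h : IsDemandNoise ν ρ W N γ P) (t : ℝ≥0) :
    MemLp (noise σ W N γ t) 2 P := by
  have h2 := h.memLp_brownian t
  have h3 := h.memLp_sum_abs_jump measurable_id h.memLp_law t
  have hm : Measurable fun ω => ∑ i ∈ Finset.range (N t ω), γ i ω :=
    measurable_sum_range_comp (h.poisson.measurable t) h.measurable_jump
  refine (h2.const_mul σ).add (h3.mono hm.aestronglyMeasurable (ae_of_all _ fun ω => ?_))
  rw [Real.norm_eq_abs, Real.norm_eq_abs]
  exact (Finset.abs_sum_le_sum_abs _ _).trans (le_abs_self _)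

/-- The second moments of the noise are bounded on `[0, T]`. -/
theorem exists_lintegral_noise_sq_le [IsProbabilityMeasure P] (h : IsDemandNoise ν ρ W N γ P)
    (T : ℝ≥0) :
    ∃ C : ℝ≥0∞, C ≠ ∞ ∧ ∀ t ≤ T, ∫⁻ ω, ENNReal.ofReal (noise σ W N γ t ω ^ 2) ∂P ≤ C := by
  set S : Ω → ℝ := fun ω => ∑ i ∈ Finset.range (N T ω), |γ i ω|
  have hS : MemLp S 2 P := h.memLp_sum_abs_jump measurable_id h.memLp_law T
  have hS2 : ∫⁻ ω, ENNReal.ofReal (S ω ^ 2) ∂P ≠ ∞ := lintegral_ofReal_sq_ne_top hS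
  refine ⟨2 * (ENNReal.ofReal (σ ^ 2) * T) + 2 * ∫⁻ ω, ENNReal.ofReal (S ω ^ 2) ∂P, ?_,
    fun t ht => ?_⟩
  · refine ENNReal.add_ne_top.2 ⟨ENNReal.mul_ne_top (by simp) ?_, ENNReal.mul_ne_top (by simp) hS2⟩
    exact ENNReal.mul_ne_top (by simp) (by simp)
  have hWm := h.measurable_brownian t
  calc ∫⁻ ω, ENNReal.ofReal (noise σ W N γ t ω ^ 2) ∂P
      ≤ ∫⁻ ω, (2 * (ENNReal.ofReal (σ ^ 2) * ENNReal.ofReal (W t ω ^ 2))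
          + 2 * ENNReal.ofReal (S ω ^ 2)) ∂P := by
        refine lintegral_mono_ae ?_
        filter_upwards [h.poisson.mono] with ω hω
        refine (ofReal_add_sq_le _ _).trans ?_
        rw [← ENNReal.ofReal_mul (sq_nonneg _), ← mul_pow]
        gcongr 2 * _ + 2 * ENNReal.ofReal ?_
        rw [← sq_abs]
        refine pow_le_pow_left₀ (abs_nonneg _) ?_ 2
        refine (Finset.abs_sum_le_sum_abs _ _).trans ?_
        exact Finset.sum_le_sum_of_subset_of_nonneg (f := fun i => |γ i ω|)
          (Finset.range_subset_range.2 (hω ht)) fun i _ _ => abs_nonneg _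
    _ = 2 * (ENNReal.ofReal (σ ^ 2) * t) + 2 * ∫⁻ ω, ENNReal.ofReal (S ω ^ 2) ∂P := by
        rw [lintegral_add_left (by fun_prop), lintegral_const_mul _ (by fun_prop),
          lintegral_const_mul _ (by fun_prop), h.lintegral_brownian_sq,
          lintegral_const_mul' _ _ (by simp)]
    _ ≤ _ := by gcongr

end IsDemandNoise

end Noise

/-! ### The increments of the noise given the observed demand -/

section Increments

/-- The σ-algebra generated by a random element. -/
abbrev generatedBy {Ω E : Type*} [MeasurableSpace E] (f : Ω → E) : MeasurableSpace Ω :=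
  MeasurableSpace.comap f inferInstance

theorem measurable_eval_generatedBy {Ω ι E : Type*} [MeasurableSpace E] (f : ι → Ω → E) (i : ι) :
    Measurable[generatedBy fun ω i => f i ω] (f i) :=
  (measurable_pi_apply i).comp (comap_measurable fun ω i => f i ω)

theorem generatedBy_le {Ω ι E : Type*} [MeasurableSpace E] [mΩ : MeasurableSpace Ω]
    {f : ι → Ω → E} (hf : ∀ i, Measurable (f i)) : (generatedBy fun ω i => f i ω) ≤ mΩ :=
  (measurable_pi_lambda _ hf).comap_le

theorem setIntegral_eq_of_indep {Ω : Type*} {K mΩ : MeasurableSpace Ω} {P : Measure Ω}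
    (hK : K ≤ mΩ) {Z : Ω → ℝ} (hZ : Measurable Z)
    (hi : Indep K (MeasurableSpace.comap Z inferInstance) P) {A : Set Ω}
    (hA : MeasurableSet[eventuallyMeasurableSpace K (ae P)] A) :
    ∫ ω in A, Z ω ∂P = P.real A * ∫ ω, Z ω ∂P := by
  obtain ⟨A', hA', hAA'⟩ := hA
  rw [setIntegral_congr_set hAA', measureReal_congr hAA']
  exact hi.setIntegral_eq_mul hK (f := id) hZ.aemeasurable hA' (by fun_prop)

/-- Let `mU` and a process `X` be independent, and `mγ` independent of both. Then `mγ`, `mU` and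
the past of `X` are together independent of the future increments of `X`. -/
theorem indep_sup_past_increment {Ω : Type*} {mγ mU mX mΩ : MeasurableSpace Ω} {P : Measure Ω}
    [IsProbabilityMeasure P] (hmγ : mγ ≤ mΩ) (hmU : mU ≤ mΩ) {X : ℝ≥0 → Ω → ℝ}
    (hX : ∀ t, Measurable (X t)) (h0 : ∀ᵐ ω ∂P, X 0 ω = 0) (hi : HasIndepIncrements X P)
    (hXm : ∀ t, Measurable[mX] (X t))
    (hUX : Indep mU mX P) (hγUX : Indep mγ (mU ⊔ mX) P) {r s : ℝ≥0} (hrs : r ≤ s) :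
    Indep (mγ ⊔ (mU ⊔ MeasurableSpace.comap (fun ω (u : Set.Iic r) => X u ω) inferInstance))
      (MeasurableSpace.comap (X s - X r) inferInstance) P := by
  have hp : MeasurableSpace.comap (fun ω (u : Set.Iic r) => X u ω) inferInstance ≤ mΩ :=
    Measurable.comap_le (measurable_pi_lambda _ fun u => hX u)
  have hf : MeasurableSpace.comap (X s - X r) inferInstance ≤ mΩ :=
    Measurable.comap_le ((hX s).sub (hX r))
  have hp' : MeasurableSpace.comap (fun ω (u : Set.Iic r) => X u ω) inferInstance ≤ mX :=
    Measurable.comap_le (@measurable_pi_lambda _ _ _ mX _ _ fun u => hXm u)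
  have hf' : MeasurableSpace.comap (X s - X r) inferInstance ≤ mX :=
    have hd : Measurable[mX] (X s - X r) := (hXm s).sub (hXm r)
    hd.comap_le
  refine indep_sup_left_of_indep_sup_right hmγ (sup_le hmU hp) hf ?_ ?_
  · exact indep_of_indep_of_le_right hγUX
      (sup_le (sup_le le_sup_left (hp'.trans le_sup_right)) (hf'.trans le_sup_right))
  · exact indep_sup_left_of_indep_sup_right hmU hp hf
      (indep_of_indep_of_le_right hUX (sup_le hp' hf')) (indep_past_increment hX h0 hi hrs)

theorem continuousWithinAt_noise {Ω : Type*} {σ : ℝ} {W : ℝ≥0 → Ω → ℝ} {N : ℝ≥0 → Ω → ℕ}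
    {γ : ℕ → Ω → ℝ} {ω : Ω} {S : Set ℝ≥0} {t : ℝ≥0}
    (hW : ContinuousWithinAt (W · ω) S t) (hN : ContinuousWithinAt (N · ω) S t) :
    ContinuousWithinAt (noise σ W N γ · ω) S t := by
  have h1 : ContinuousAt (fun n : ℕ => ∑ i ∈ Finset.range n, γ i ω) (N t ω) :=
    continuous_of_discreteTopology.continuousAt
  exact (continuousWithinAt_const.mul hW).add
    (ContinuousAt.comp_continuousWithinAt (f := fun u => N u ω) h1 hN)

variable {Ω : Type*} [mΩ : MeasurableSpace Ω] {P : Measure Ω}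
  {σ κ y₀ : ℝ} {μ : ℝ → ℝ} {ν T : ℝ≥0} {ρ : Measure ℝ} {W : ℝ≥0 → Ω → ℝ} {N : ℝ≥0 → Ω → ℕ}
  {γ : ℕ → Ω → ℝ} {Y : ℝ≥0 → Ω → ℝ}

theorem IsDemandNoise.ae_right_continuous_noise (h : IsDemandNoise ν ρ W N γ P)
    (γ' : ℕ → Ω → ℝ) :
    ∀ᵐ ω ∂P, ∀ t, ContinuousWithinAt (noise σ W N γ' · ω) (Set.Ici t) t := by
  filter_upwards [h.brownian.cont, h.poisson.right_cont] with ω h1 h2 t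
  exact continuousWithinAt_noise h1.continuousWithinAt (h2 t)

namespace IsDemandNoise

theorem measurable_natCast_poisson (h : IsDemandNoise ν ρ W N γ P) (t : ℝ≥0) :
    Measurable fun ω => (N t ω : ℝ) :=
  (measurable_from_nat (f := fun n : ℕ => (n : ℝ))).comp (h.poisson.measurable t)

theorem integrable_poisson [IsProbabilityMeasure P] (h : IsDemandNoise ν ρ W N γ P) (t : ℝ≥0) :
    Integrable (fun ω => (N t ω : ℝ)) P :=
  (h.poisson.memLp t).integrable one_le_two

theorem indep_jump_sup (h : IsDemandNoise ν ρ W N γ P) :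
    Indep (generatedBy fun ω i => γ i ω)
      ((generatedBy fun ω t => W t ω) ⊔ generatedBy fun ω t => N t ω) P := by
  have e : generatedBy (fun ω => ((fun t => W t ω), (fun t => N t ω)))
      = (generatedBy fun ω t => W t ω) ⊔ generatedBy fun ω t => N t ω :=
    MeasurableSpace.comap_prodMk _ _
  rw [← e]
  exact h.indepFun_jump

/-- If `K` knows the noise up to time `r`, and `Z` is independent of `K`, then `Z` has its
unconditional mean on every event that can be read off the demand up to time `r`. -/
theorem setIntegral_eq_of_indep_of_measurable_noise {Ω : Type*} {K mΩ : MeasurableSpace Ω}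
    {P : Measure Ω} {W : ℝ≥0 → Ω → ℝ} {N : ℝ≥0 → Ω → ℕ} {γ : ℕ → Ω → ℝ} {Y : ℝ≥0 → Ω → ℝ}
    (h : IsDemandNoise ν ρ W N γ P) (hμ : IntervalIntegrable μ volume 0 T)
    (hYm : ∀ t, StronglyMeasurable (Y t))
    (hsol : ∀ᵐ ω ∂P, IsPathSolution κ y₀ μ T (noise σ W N γ · ω) (Y · ω)) {r : ℝ≥0}
    (hr : r ≤ T) {A : Set Ω} (hA : MeasurableSet[Filtration.natural Y hYm r] A) {Z : Ω → ℝ}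
    (hZ : Measurable Z) (hi : Indep K (MeasurableSpace.comap Z inferInstance) P) (hK : K ≤ mΩ)
    (hW : ∀ u ≤ r, Measurable[K] (W u)) (hN : ∀ u ≤ r, Measurable[K] (N u))
    (hγ : ∀ i, Measurable[K] (γ i)) :
    ∫ ω in A, Z ω ∂P = P.real A * ∫ ω, Z ω ∂P := by
  refine setIntegral_eq_of_indep hK hZ hi (natural_le_eventuallyMeasurableSpace (Q := P)
    (hμ.mono_set (Set.uIcc_subset_uIcc_left (by simp [hr]))) hYm
    (fun u hu => @measurable_noise Ω K σ W N γ u (hW u hu) (hN u hu) hγ)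
    ((h.ae_right_continuous_noise γ).mono fun ω hω s _ => hω s)
    (hsol.mono fun ω hω => hω.mono hr) A hA)

theorem setIntegral_brownian_increment [IsProbabilityMeasure P] (h : IsDemandNoise ν ρ W N γ P)
    (hμ : IntervalIntegrable μ volume 0 T) (hYm : ∀ t, StronglyMeasurable (Y t))
    (hsol : ∀ᵐ ω ∂P, IsPathSolution κ y₀ μ T (noise σ W N γ · ω) (Y · ω)) {r s : ℝ≥0}
    (hr : r ≤ T) (hrs : r ≤ s) {A : Set Ω} (hA : MeasurableSet[Filtration.natural Y hYm r] A) :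
    ∫ ω in A, (W s ω - W r ω) ∂P = 0 := by
  have hi := indep_sup_past_increment (generatedBy_le h.measurable_jump)
    (generatedBy_le h.poisson.measurable) h.measurable_brownian
    h.brownian.eval_zero_ae_eq_zero h.brownian.hasIndepIncrements (measurable_eval_generatedBy W)
    h.indepFun_brownian_poisson.symm (by rw [sup_comm]; exact h.indep_jump_sup) hrs
  have := h.setIntegral_eq_of_indep_of_measurable_noise hμ hYm hsol hr hA
    ((h.measurable_brownian s).sub (h.measurable_brownian r)) hi
    (sup_le (generatedBy_le h.measurable_jump) (sup_le (generatedBy_le h.poisson.measurable)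
      (generatedBy_le fun u : Set.Iic r => h.measurable_brownian u)))
    (fun u hu => (measurable_eval_generatedBy (fun u : Set.Iic r => W u) ⟨u, hu⟩).mono
      (le_sup_right.trans le_sup_right) le_rfl)
    (fun u _ => (measurable_eval_generatedBy N u).mono (le_sup_left.trans le_sup_right) le_rfl)
    (fun i => (measurable_eval_generatedBy γ i).mono le_sup_left le_rfl)
  simp only [Pi.sub_apply] at this
  rw [this, integral_sub (h.brownian.integrable_eval s) (h.brownian.integrable_eval r),
    h.brownian.integral_eval, h.brownian.integral_eval, sub_zero, mul_zero]

theorem setIntegral_poisson_increment [IsProbabilityMeasure P] (h : IsDemandNoise ν ρ W N γ P)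
    (hμ : IntervalIntegrable μ volume 0 T) (hYm : ∀ t, StronglyMeasurable (Y t))
    (hsol : ∀ᵐ ω ∂P, IsPathSolution κ y₀ μ T (noise σ W N γ · ω) (Y · ω)) {r s : ℝ≥0}
    (hr : r ≤ T) (hrs : r ≤ s) {A : Set Ω} (hA : MeasurableSet[Filtration.natural Y hYm r] A) :
    ∫ ω in A, ((N s ω : ℝ) - N r ω) ∂P = P.real A * (ν * (s - r)) := by
  have hi := indep_sup_past_increment (generatedBy_le h.measurable_jump)
    (generatedBy_le h.measurable_brownian) (X := fun t ω => (N t ω : ℝ))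
    h.measurable_natCast_poisson (h.poisson.zero.mono fun ω hω => by simp [hω]) h.poisson.indep
    (fun t => (measurable_from_nat (f := fun n : ℕ => (n : ℝ))).comp
      (measurable_eval_generatedBy N t))
    h.indepFun_brownian_poisson h.indep_jump_sup hrs
  have := h.setIntegral_eq_of_indep_of_measurable_noise hμ hYm hsol hr hA
    ((h.measurable_natCast_poisson s).sub (h.measurable_natCast_poisson r)) hi
    (sup_le (generatedBy_le h.measurable_jump) (sup_le (generatedBy_le h.measurable_brownian)
      (generatedBy_le fun u : Set.Iic r => h.measurable_natCast_poisson u)))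
    (fun u _ => (measurable_eval_generatedBy W u).mono (le_sup_left.trans le_sup_right) le_rfl)
    (fun u hu => by
      -- the σ-algebra is generated by the real-valued process, from which `N` is recovered
      have h1 := Nat.measurable_floor.comp
        (measurable_eval_generatedBy (fun (u : Set.Iic r) ω => (N u ω : ℝ)) ⟨u, hu⟩)
      simp only [Function.comp_def, Nat.floor_natCast] at h1
      exact h1.mono (le_sup_right.trans le_sup_right) le_rfl)
    (fun i => (measurable_eval_generatedBy γ i).mono le_sup_left le_rfl)
  simp only [Pi.sub_apply] at this
  rw [this, integral_sub (h.integrable_poisson s) (h.integrable_poisson r),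
    h.poisson.integral_eval, h.poisson.integral_eval, ← mul_sub]

theorem integral_jump [IsProbabilityMeasure P] (h : IsDemandNoise ν ρ W N γ P) (i : ℕ) :
    ∫ ω, γ i ω ∂P = ∫ x, x ∂ρ :=
  (h.hasLaw_jump i).integral_eq

theorem integrable_jump [IsProbabilityMeasure P] (h : IsDemandNoise ν ρ W N γ P) (i : ℕ) :
    Integrable (γ i) P := by
  have := h.isProbabilityMeasure_law
  have h1 : Integrable id ρ := h.memLp_law.integrable one_le_two
  rw [← (h.hasLaw_jump i).map_eq,
    integrable_map_measure (by fun_prop) (h.measurable_jump i).aemeasurable] at h1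
  exact h1

/-- On `{N_r ≤ i}` the noise up to time `r`, and with it the demand, involves none but the first
`i` jump heights. Hence `γ i` keeps its mean on events that can be read off the demand up to time
`r`, if on these events the jump occurs after `r`. -/
theorem setIntegral_jump_of_indep {Ω : Type*} {K mΩ : MeasurableSpace Ω} {P : Measure Ω}
    [IsProbabilityMeasure P] {W : ℝ≥0 → Ω → ℝ} {N : ℝ≥0 → Ω → ℕ} {γ : ℕ → Ω → ℝ}
    {Y : ℝ≥0 → Ω → ℝ} (h : IsDemandNoise ν ρ W N γ P) (hμ : IntervalIntegrable μ volume 0 T)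
    (hYm : ∀ t, StronglyMeasurable (Y t))
    (hsol : ∀ᵐ ω ∂P, IsPathSolution κ y₀ μ T (noise σ W N γ · ω) (Y · ω)) {r : ℝ≥0} (s : ℝ≥0)
    (hr : r ≤ T) {A : Set Ω} (hA : MeasurableSet[Filtration.natural Y hYm r] A) (i : ℕ)
    (hK : K ≤ mΩ) (hi : Indep K (generatedBy (γ i)) P) (hW : ∀ u, Measurable[K] (W u))
    (hN : ∀ u, Measurable[K] (N u)) (hγ : ∀ j < i, Measurable[K] (γ j)) :
    ∫ ω in A ∩ {ω | N r ω ≤ i ∧ i < N s ω}, (γ i ω - ∫ x, x ∂ρ) ∂P = 0 := by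
  -- the driver with the truncated jumps agrees with the noise up to time `r` on `{N_r ≤ i}`
  set γ' : ℕ → Ω → ℝ := fun j => if j < i then γ j else 0 with hγ'
  have hγK : ∀ j, Measurable[K] (γ' j) := by
    intro j
    by_cases hj : j < i
    · simpa only [hγ', hj, if_true] using hγ j hj
    · simp only [hγ', hj, if_false]
      exact @measurable_const _ _ _ K _
  have hB : MeasurableSet {ω | N r ω ≤ i} := h.poisson.measurable r measurableSet_Iic
  have hsol' : ∀ᵐ ω ∂P.restrict {ω | N r ω ≤ i},
      IsPathSolution κ y₀ μ r (noise σ W N γ' · ω) (Y · ω) := by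
    rw [ae_restrict_iff' hB]
    filter_upwards [hsol, h.poisson.mono] with ω h1 h2 h3
    refine (h1.mono hr).congr_driver fun u hu => ?_
    simp only [noise]
    congr 1
    refine Finset.sum_congr rfl fun j hj => ?_
    have : j < i := (Finset.mem_range.1 hj).trans_le ((h2 hu).trans h3)
    simp [hγ', this]
  have hX : ∀ u ≤ r, Measurable[K] (noise σ W N γ' u) := fun u _ =>
    @measurable_noise Ω K σ W N γ' u (hW u) (hN u) hγK
  obtain ⟨A', hA', hAA'⟩ := natural_le_eventuallyMeasurableSpace
    (hμ.mono_set (Set.uIcc_subset_uIcc_left (by simp [hr]))) hYm hX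
    (ae_restrict_of_ae ((h.ae_right_continuous_noise γ').mono fun ω hω s _ => hω s)) hsol' A hA
  have hCK : MeasurableSet[K] (A' ∩ {ω | N r ω ≤ i ∧ i < N s ω}) :=
    hA'.inter (MeasurableSet.inter (hN r (measurableSet_Iic (a := i)))
      (hN s (measurableSet_Ioi (a := i))))
  have hAC : (A ∩ {ω | N r ω ≤ i ∧ i < N s ω} : Set Ω)
      =ᵐ[P] (A' ∩ {ω | N r ω ≤ i ∧ i < N s ω} : Set Ω) := by
    have h1 := (ae_restrict_iff' hB).1 hAA'
    filter_upwards [h1] with ω hω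
    by_cases hr : N r ω ≤ i
    · have h2 : (ω ∈ A) = (ω ∈ A') := hω hr
      exact congrArg (· ∧ (N r ω ≤ i ∧ i < N s ω)) h2
    · have : ∀ D : Set Ω, (D ∩ {ω | N r ω ≤ i ∧ i < N s ω}) ω = False := fun D =>
        eq_false fun hD => hr hD.2.1
      rw [this, this]
  rw [setIntegral_congr_set hAC, hi.setIntegral_eq_mul (f := fun x => x - ∫ x, x ∂ρ)
    hK (h.measurable_jump i).aemeasurable hCK (by fun_prop),
    integral_sub (h.integrable_jump i) (integrable_const _), h.integral_jump]
  simp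

/-- `setIntegral_jump_of_indep`, for the σ-algebra that is generated by `W`, `N` and the jump
heights with an index below `i`. -/
theorem setIntegral_jump [IsProbabilityMeasure P] (h : IsDemandNoise ν ρ W N γ P)
    (hμ : IntervalIntegrable μ volume 0 T) (hYm : ∀ t, StronglyMeasurable (Y t))
    (hsol : ∀ᵐ ω ∂P, IsPathSolution κ y₀ μ T (noise σ W N γ · ω) (Y · ω)) {r : ℝ≥0} (s : ℝ≥0)
    (hr : r ≤ T) {A : Set Ω} (hA : MeasurableSet[Filtration.natural Y hYm r] A) (i : ℕ) :
    ∫ ω in A ∩ {ω | N r ω ≤ i ∧ i < N s ω}, (γ i ω - ∫ x, x ∂ρ) ∂P = 0 := by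
  have hγle : (generatedBy fun ω (j : Finset.range i) => γ j ω) ≤ mΩ :=
    generatedBy_le fun j : Finset.range i => h.measurable_jump j
  have hWNle : (generatedBy fun ω t => W t ω) ⊔ (generatedBy fun ω t => N t ω) ≤ mΩ :=
    sup_le (generatedBy_le h.measurable_brownian) (generatedBy_le h.poisson.measurable)
  have hi : Indep (((generatedBy fun ω t => W t ω) ⊔ generatedBy fun ω t => N t ω)
      ⊔ generatedBy fun ω (j : Finset.range i) => γ j ω) (generatedBy (γ i)) P := by
    refine indep_sup_left_of_indep_sup_right hWNle hγle (h.measurable_jump i).comap_le ?_ ?_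
    · refine indep_of_indep_of_le_right h.indep_jump_sup.symm (sup_le ?_ ?_)
      · exact (@measurable_pi_lambda _ _ _ (generatedBy fun ω i => γ i ω) _ _
          fun j : Finset.range i => measurable_eval_generatedBy γ j).comap_le
      · exact (measurable_eval_generatedBy γ i).comap_le
    · have hψ : Measurable fun v : ({i} : Finset ℕ) → ℝ => v ⟨i, by simp⟩ :=
        measurable_pi_apply _
      exact (h.iIndepFun_jump.indepFun_finset (Finset.range i) {i} (by simp)
        h.measurable_jump).comp measurable_id hψ
  exact h.setIntegral_jump_of_indep hμ hYm hsol s hr hA i (sup_le hWNle hγle) hi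
    (fun u => (measurable_eval_generatedBy W u).mono (le_sup_left.trans le_sup_left) le_rfl)
    (fun u => (measurable_eval_generatedBy N u).mono (le_sup_right.trans le_sup_left) le_rfl)
    (fun j hj => (measurable_eval_generatedBy (fun j : Finset.range i => γ j)
      ⟨j, Finset.mem_range.2 hj⟩).mono le_sup_right le_rfl)

/-- The compensated jumps between `r` and `s` have mean zero on every event that can be read off
the demand up to time `r`. -/
theorem setIntegral_compensated_jumps [IsProbabilityMeasure P] (h : IsDemandNoise ν ρ W N γ P)
    (hμ : IntervalIntegrable μ volume 0 T) (hYm : ∀ t, StronglyMeasurable (Y t))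
    (hsol : ∀ᵐ ω ∂P, IsPathSolution κ y₀ μ T (noise σ W N γ · ω) (Y · ω)) {r s : ℝ≥0}
    (hr : r ≤ T) (hrs : r ≤ s) {A : Set Ω} (hA : MeasurableSet[Filtration.natural Y hYm r] A) :
    ∫ ω in A, (∑ i ∈ Finset.range (N s ω), (γ i ω - ∫ x, x ∂ρ)
      - ∑ i ∈ Finset.range (N r ω), (γ i ω - ∫ x, x ∂ρ)) ∂P = 0 := by
  have := h.isProbabilityMeasure_law
  set c := ∫ x, x ∂ρ
  set C : ℕ → Set Ω := fun i => {ω | N r ω ≤ i ∧ i < N s ω} with hC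
  have hCm : ∀ i, MeasurableSet (C i) := fun i =>
    (h.poisson.measurable r (measurableSet_Iic (a := i))).inter
      (h.poisson.measurable s (measurableSet_Ioi (a := i)))
  have hZm : ∀ i, Measurable fun ω => γ i ω - c := fun i => (h.measurable_jump i).sub_const c
  -- the sum over all jumps in `(r, s]` is the limit of the sums over those with an index `< n`
  set F : ℕ → Ω → ℝ := fun n ω => ∑ i ∈ Finset.range n, (C i).indicator (fun ω => γ i ω - c) ω
    with hF
  have hZint : ∀ i, Integrable (fun ω => γ i ω - c) P := fun i =>
    (h.integrable_jump i).sub (integrable_const _)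
  have hF0 : ∀ n, ∫ ω in A, F n ω ∂P = 0 := by
    intro n
    rw [integral_finsetSum _ fun i _ => ((hZint i).indicator (hCm i)).integrableOn]
    refine Finset.sum_eq_zero fun i _ => ?_
    rw [setIntegral_indicator (hCm i)]
    exact h.setIntegral_jump hμ hYm hsol s hr hA i
  have hbound := (h.memLp_sum_abs_jump (f := fun x => x - c) (by fun_prop)
    (h.memLp_law.sub (memLp_const c)) s).integrable one_le_two
  have hlim := tendsto_integral_of_dominated_convergence (μ := P.restrict A) (F := F) (f := fun ω =>
      ∑ i ∈ Finset.range (N s ω), (γ i ω - c) - ∑ i ∈ Finset.range (N r ω), (γ i ω - c))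
    (fun ω => ∑ i ∈ Finset.range (N s ω), |γ i ω - c|)
    (fun n => (Finset.measurable_sum _ fun i _ =>
      (hZm i).indicator (hCm i)).aestronglyMeasurable) hbound.integrableOn ?_ ?_
  · simp only [hF0] at hlim
    exact tendsto_nhds_unique hlim tendsto_const_nhds
  · refine fun n => ae_of_all _ fun ω => ?_
    rw [Real.norm_eq_abs]
    refine (Finset.abs_sum_le_sum_abs _ _).trans ?_
    calc ∑ i ∈ Finset.range n, |(C i).indicator (fun ω => γ i ω - c) ω|
        ≤ ∑ i ∈ Finset.range n, if i < N s ω then |γ i ω - c| else 0 := by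
          refine Finset.sum_le_sum fun i _ => ?_
          by_cases hi : ω ∈ C i
          · rw [Set.indicator_of_mem hi, if_pos hi.2]
          · rw [Set.indicator_of_notMem hi, abs_zero]
            split_ifs <;> simp
      _ = ∑ i ∈ (Finset.range n).filter (· < N s ω), |γ i ω - c| :=
          (Finset.sum_filter _ _).symm
      _ ≤ _ := by
          refine Finset.sum_le_sum_of_subset_of_nonneg (fun i hi => ?_) fun i _ _ => abs_nonneg _
          exact Finset.mem_range.2 (Finset.mem_filter.1 hi).2
  · refine ae_restrict_of_ae ?_
    filter_upwards [h.poisson.mono] with ω hω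
    refine tendsto_const_nhds.congr' ?_
    filter_upwards [eventually_ge_atTop (N s ω)] with n hn
    rw [← Finset.sum_Ico_eq_sub _ (hω hrs)]
    simp only [hF, Set.indicator_apply, hC, Set.mem_ofPred_eq]
    rw [← Finset.sum_filter]
    refine Finset.sum_congr ?_ fun _ _ => rfl
    ext i
    simp only [Finset.mem_Ico, Finset.mem_filter, Finset.mem_range]
    omega

/-- The increments of the noise have their unconditional mean `γ̄ ν (s - r)` on every event that
can be read off the demand up to time `r`. -/
theorem setIntegral_noise_increment [IsProbabilityMeasure P] (h : IsDemandNoise ν ρ W N γ P)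
    (hμ : IntervalIntegrable μ volume 0 T) (hYm : ∀ t, StronglyMeasurable (Y t))
    (hsol : ∀ᵐ ω ∂P, IsPathSolution κ y₀ μ T (noise σ W N γ · ω) (Y · ω)) {r s : ℝ≥0}
    (hr : r ≤ T) (hrs : r ≤ s) {A : Set Ω} (hA : MeasurableSet[Filtration.natural Y hYm r] A) :
    ∫ ω in A, (noise σ W N γ s ω - noise σ W N γ r ω) ∂P
      = P.real A * ((∫ x, x ∂ρ) * ν * (s - r)) := by
  have hW := h.setIntegral_brownian_increment hμ hYm hsol hr hrs hA
  have hN := h.setIntegral_poisson_increment hμ hYm hsol hr hrs hA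
  have hJ := h.setIntegral_compensated_jumps hμ hYm hsol hr hrs hA
  set c := ∫ x, x ∂ρ
  have iW : Integrable (fun ω => W s ω - W r ω) P :=
    (h.brownian.integrable_eval s).sub (h.brownian.integrable_eval r)
  have iN : Integrable (fun ω => (N s ω : ℝ) - N r ω) P :=
    (h.integrable_poisson s).sub (h.integrable_poisson r)
  have iX : Integrable (fun ω => noise σ W N γ s ω - noise σ W N γ r ω) P :=
    ((h.memLp_noise s).integrable one_le_two).sub ((h.memLp_noise r).integrable one_le_two)
  have e : ∀ ω, (∑ i ∈ Finset.range (N s ω), (γ i ω - c) - ∑ i ∈ Finset.range (N r ω), (γ i ω - c))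
      = (noise σ W N γ s ω - noise σ W N γ r ω) - σ * (W s ω - W r ω)
        - c * ((N s ω : ℝ) - N r ω) := by
    intro ω
    simp only [noise, Finset.sum_sub_distrib, Finset.sum_const, Finset.card_range, nsmul_eq_mul]
    ring
  simp only [e] at hJ
  have iXW : Integrable (fun ω => noise σ W N γ s ω - noise σ W N γ r ω - σ * (W s ω - W r ω)) P :=
    iX.sub (iW.const_mul σ)
  rw [integral_sub iXW.integrableOn (iN.const_mul c).integrableOn,
    integral_sub iX.integrableOn (iW.const_mul σ).integrableOn, integral_const_mul,
    integral_const_mul, hW, hN] at hJ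
  linarith

end IsDemandNoise

end Increments

/-! ### Second moments of the demand -/

/-- The Cauchy-Schwarz inequality on `[0, T]`. -/
theorem ofReal_sq_integral_abs_le {T : ℝ≥0} {x : ℝ → ℝ} (hx : IntervalIntegrable x volume 0 T) :
    ENNReal.ofReal ((∫ s in (0 : ℝ)..T, |x s|) ^ 2)
      ≤ T * ∫⁻ s in Set.Icc (0 : ℝ) T, ENNReal.ofReal (x s ^ 2) := by
  have hx' : IntegrableOn x (Set.Ioc 0 (T : ℝ)) :=
    (intervalIntegrable_iff_integrableOn_Ioc_of_le T.coe_nonneg).1 hx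
  rw [intervalIntegral.integral_of_le T.coe_nonneg, ENNReal.ofReal_pow (by positivity),
    ofReal_integral_eq_lintegral_ofReal hx'.abs (ae_of_all _ fun s => abs_nonneg _),
    ← restrict_Ioc_eq_restrict_Icc]
  have h := ENNReal.lintegral_mul_le_Lp_mul_Lq (volume.restrict (Set.Ioc 0 (T : ℝ)))
    (Real.HolderConjugate.two_two) (f := fun s => ENNReal.ofReal |x s|) (g := fun _ => 1)
    hx'.abs.aestronglyMeasurable.aemeasurable.ennreal_ofReal aemeasurable_const
  simp only [Pi.mul_apply, mul_one, ENNReal.rpow_two, one_pow, lintegral_one,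
    Measure.restrict_apply MeasurableSet.univ, Set.univ_inter, Real.volume_Ioc, sub_zero,
    ENNReal.ofReal_coe_nnreal] at h
  have h2 : ∀ s, ENNReal.ofReal |x s| ^ 2 = ENNReal.ofReal (x s ^ 2) := fun s => by
    rw [← ENNReal.ofReal_pow (abs_nonneg _), sq_abs]
  simp only [h2] at h
  calc _ ≤ ((∫⁻ s in Set.Ioc (0 : ℝ) T, ENNReal.ofReal (x s ^ 2)) ^ (1 / 2 : ℝ)
        * (T : ℝ≥0∞) ^ (1 / 2 : ℝ)) ^ 2 := by gcongr
    _ = _ := by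
      rw [mul_pow, ← ENNReal.rpow_two, ← ENNReal.rpow_two, ← ENNReal.rpow_mul, ← ENNReal.rpow_mul]
      norm_num
      rw [mul_comm]

section Demand

variable {Ω : Type*} [mΩ : MeasurableSpace Ω] {P : Measure Ω}
  {σ κ y₀ : ℝ} {μ : ℝ → ℝ} {ν T : ℝ≥0} {ρ : Measure ℝ} {W : ℝ≥0 → Ω → ℝ} {N : ℝ≥0 → Ω → ℕ}
  {γ : ℕ → Ω → ℝ} {Y : ℝ≥0 → Ω → ℝ}

theorem aestronglyMeasurable_of_ae_right_continuous [SFinite P] {X : ℝ≥0 → Ω → ℝ}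
    (hX : ∀ t, Measurable (X t))
    (hrc : ∀ᵐ ω ∂P, ∀ s < T, ContinuousWithinAt (X · ω) (Set.Ici s) s) :
    AEStronglyMeasurable (fun p : ℝ × Ω => X p.1.toNNReal p.2)
      ((volume.restrict (Set.Icc (0 : ℝ) T)).prod P) := by
  obtain ⟨Z, hZ, hZX⟩ := exists_measurable_version (r := T) fun t _ => hX t
  have hZ' : Measurable fun p : ℝ × Ω => Z (p.1.toNNReal, p.2) := by fun_prop
  refine hZ'.aestronglyMeasurable.congr ?_
  have h1 : ∀ᵐ p ∂(volume.restrict (Set.Icc (0 : ℝ) T)).prod P, p.1 ∈ Set.Icc (0 : ℝ) T :=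
    Measure.quasiMeasurePreserving_fst.ae (ae_restrict_mem measurableSet_Icc)
  have h2 : ∀ᵐ p ∂(volume.restrict (Set.Icc (0 : ℝ) T)).prod P,
      ∀ s < T, ContinuousWithinAt (X · p.2) (Set.Ici s) s :=
    Measure.quasiMeasurePreserving_snd.ae hrc
  filter_upwards [h1, h2] with p h1 h2
  exact hZX p.2 h2 _ (Real.toNNReal_le_iff_le_coe.2 h1.2)

/-- The demand is right-continuous on `[0, T)`. -/
theorem IsDemandNoise.ae_right_continuous_demand (h : IsDemandNoise ν ρ W N γ P)
    (hμ : IntervalIntegrable μ volume 0 T)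
    (hsol : ∀ᵐ ω ∂P, IsPathSolution κ y₀ μ T (noise σ W N γ · ω) (Y · ω)) :
    ∀ᵐ ω ∂P, ∀ s < T, ContinuousWithinAt (Y · ω) (Set.Ici s) s := by
  filter_upwards [hsol, h.ae_right_continuous_noise γ] with ω h1 h2 s hs
  have h3 := h1.continuousWithinAt hμ hs.le (S := Set.Ici s ∩ Set.Iic T)
    Set.inter_subset_right ((h2 s).mono Set.inter_subset_left)
  exact h3.mono_of_mem_nhdsWithin
    (inter_mem self_mem_nhdsWithin (mem_nhdsWithin_of_mem_nhds (Iic_mem_nhds hs)))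

/-- The second moments of the demand are bounded on `[0, T]`. -/
theorem IsDemandNoise.exists_lintegral_demand_sq_le [IsProbabilityMeasure P]
    (h : IsDemandNoise ν ρ W N γ P) (hκ : 0 ≤ κ) (hμ : IntervalIntegrable μ volume 0 T)
    (hsol : ∀ᵐ ω ∂P, IsPathSolution κ y₀ μ T (noise σ W N γ · ω) (Y · ω)) :
    ∃ C : ℝ≥0∞, C ≠ ∞ ∧ ∀ t ≤ T, ∫⁻ ω, ENNReal.ofReal (Y t ω ^ 2) ∂P ≤ C := by
  obtain ⟨C, hC, hXC⟩ := h.exists_lintegral_noise_sq_le (σ := σ) T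
  have hXm : ∀ t, Measurable (noise σ W N γ t) := fun t =>
    measurable_noise (h.measurable_brownian t) (h.poisson.measurable t) h.measurable_jump
  have hXj := aestronglyMeasurable_of_ae_right_continuous (T := T) hXm
    ((h.ae_right_continuous_noise (σ := σ) γ).mono fun ω hω s _ => hω s)
  set c : ℝ := |y₀| + κ * (∫ s in (0 : ℝ)..T, |μ s|)
  set I : Ω → ℝ := fun ω => ∫ s in (0 : ℝ)..T, |noise σ W N γ s.toNNReal ω| with hI
  have hI2 : ∫⁻ ω, ENNReal.ofReal (I ω ^ 2) ∂P ≤ T * (T * C) := by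
    calc ∫⁻ ω, ENNReal.ofReal (I ω ^ 2) ∂P
        ≤ ∫⁻ ω, T * (∫⁻ s in Set.Icc (0 : ℝ) T,
            ENNReal.ofReal (noise σ W N γ s.toNNReal ω ^ 2)) ∂P := by
          refine lintegral_mono_ae ?_
          filter_upwards [hsol] with ω hω
          exact ofReal_sq_integral_abs_le (hω.intervalIntegrable_driver hμ)
      _ = T * ∫⁻ s in Set.Icc (0 : ℝ) T, ∫⁻ ω,
            ENNReal.ofReal (noise σ W N γ s.toNNReal ω ^ 2) ∂P := by
          rw [lintegral_const_mul' _ _ (by simp),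
            ← lintegral_lintegral_swap
              (f := fun (s : ℝ) ω => ENNReal.ofReal (noise σ W N γ s.toNNReal ω ^ 2))]
          exact (hXj.aemeasurable.pow_const 2).ennreal_ofReal
      _ ≤ T * ∫⁻ s in Set.Icc (0 : ℝ) T, C := by
          gcongr 1
          refine setLIntegral_mono measurable_const fun s hs => ?_
          exact hXC _ (Real.toNNReal_le_iff_le_coe.2 hs.2)
      _ = T * (T * C) := by
          rw [setLIntegral_const, Real.volume_Icc, sub_zero, ENNReal.ofReal_coe_nnreal,
            mul_comm C]
  refine ⟨2 * (2 * ENNReal.ofReal (c ^ 2) + 2 * (ENNReal.ofReal (κ ^ 2) * (T * (T * C)))) + 2 * C,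
    by finiteness, fun t ht => ?_⟩
  calc ∫⁻ ω, ENNReal.ofReal (Y t ω ^ 2) ∂P
      ≤ ∫⁻ ω, (2 * (2 * ENNReal.ofReal (c ^ 2)
          + 2 * (ENNReal.ofReal (κ ^ 2) * ENNReal.ofReal (I ω ^ 2)))
          + 2 * ENNReal.ofReal (noise σ W N γ t ω ^ 2)) ∂P := by
        refine lintegral_mono_ae ?_
        filter_upwards [hsol] with ω hω
        have h1 := hω.abs_le hκ hμ ht
        calc ENNReal.ofReal (Y t ω ^ 2)
            ≤ ENNReal.ofReal ((c + κ * I ω + |noise σ W N γ t ω|) ^ 2) := by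
              refine ENNReal.ofReal_le_ofReal ?_
              rw [← sq_abs]
              exact pow_le_pow_left₀ (abs_nonneg _) h1 2
          _ ≤ 2 * ENNReal.ofReal ((c + κ * I ω) ^ 2)
              + 2 * ENNReal.ofReal (|noise σ W N γ t ω| ^ 2) := ofReal_add_sq_le _ _
          _ ≤ _ := by
              rw [sq_abs, ← ENNReal.ofReal_mul (sq_nonneg _), ← mul_pow]
              gcongr
              exact ofReal_add_sq_le _ _
    _ = 2 * (2 * ENNReal.ofReal (c ^ 2)
          + 2 * (ENNReal.ofReal (κ ^ 2) * ∫⁻ ω, ENNReal.ofReal (I ω ^ 2) ∂P))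
          + 2 * ∫⁻ ω, ENNReal.ofReal (noise σ W N γ t ω ^ 2) ∂P := by
        have hm := hXm t
        rw [lintegral_add_right _ (by fun_prop), lintegral_const_mul' _ _ (by simp),
          lintegral_add_left measurable_const, lintegral_const_mul' _ _ (by simp),
          lintegral_const_mul' _ _ (by simp), lintegral_const, measure_univ, mul_one,
          lintegral_const_mul' _ _ (by simp), lintegral_const_mul' _ _ (by simp)]
    _ ≤ _ := by
        gcongr
        exact hXC t ht

theorem IsDemandNoise.memLp_demand [IsProbabilityMeasure P]
    (h : IsDemandNoise ν ρ W N γ P) (hκ : 0 ≤ κ) (hμ : IntervalIntegrable μ volume 0 T)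
    (hYm : ∀ t, StronglyMeasurable (Y t))
    (hsol : ∀ᵐ ω ∂P, IsPathSolution κ y₀ μ T (noise σ W N γ · ω) (Y · ω)) {t : ℝ≥0} (ht : t ≤ T) :
    MemLp (Y t) 2 P := by
  obtain ⟨C, hC, hYC⟩ := h.exists_lintegral_demand_sq_le hκ hμ hsol
  exact memLp_two_of_lintegral_ne_top (hYm t).aestronglyMeasurable
    (((hYC t ht).trans_lt hC.lt_top).ne)

theorem IsDemandNoise.memLp_demand_prod [IsProbabilityMeasure P]
    (h : IsDemandNoise ν ρ W N γ P) (hκ : 0 ≤ κ) (hμ : IntervalIntegrable μ volume 0 T)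
    (hYm : ∀ t, StronglyMeasurable (Y t))
    (hsol : ∀ᵐ ω ∂P, IsPathSolution κ y₀ μ T (noise σ W N γ · ω) (Y · ω)) :
    MemLp (fun p : ℝ × Ω => Y p.1.toNNReal p.2) 2
      ((volume.restrict (Set.Icc (0 : ℝ) T)).prod P) := by
  obtain ⟨C, hC, hYC⟩ := h.exists_lintegral_demand_sq_le hκ hμ hsol
  have hm := aestronglyMeasurable_of_ae_right_continuous (T := T) (fun t => (hYm t).measurable)
    (h.ae_right_continuous_demand hμ hsol)
  refine memLp_two_of_lintegral_ne_top hm ?_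
  rw [lintegral_prod _ (hm.aemeasurable.pow_const 2).ennreal_ofReal]
  refine ((setLIntegral_mono (g := fun _ => C) measurable_const fun s hs => ?_).trans_lt ?_).ne
  · exact hYC _ (Real.toNNReal_le_iff_le_coe.2 hs.2)
  · rw [setLIntegral_const, Real.volume_Icc]
    finiteness

end Demand

/-! ### The controls as conditional expectations -/

theorem integral_mul_exp_eq (κ : ℝ) {a b : ℝ} (hab : a ≤ b) :
    ∫ s in a..b, Real.exp (-κ * (b - s)) * κ = 1 - Real.exp (-κ * (b - a)) := by
  have := eq_of_linear_integral_equation (κ := κ) (c := 1) (q := fun _ => κ) (f := fun _ => 1) hab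
    intervalIntegrable_const intervalIntegrable_const (fun t _ => by simp)
  simp only [mul_one] at this
  linarith

theorem intervalIntegrable_exp_mul {κ a b c : ℝ} {q : ℝ → ℝ}
    (hq : IntervalIntegrable q volume a b) :
    IntervalIntegrable (fun s => Real.exp (-κ * (c - s)) * q s) volume a b :=
  hq.continuousOn_mul (by fun_prop)

theorem stronglyMeasurable_control {Ω : Type*} {F : MeasurableSpace Ω} {κ γbar : ℝ} {ν lam : ℝ≥0}
    {μ : ℝ → ℝ} {Y : ℝ≥0 → Ω → ℝ} {t r : ℝ≥0} (hY : StronglyMeasurable[F] (Y r)) :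
    StronglyMeasurable[F] (control κ γbar ν lam μ Y t r) :=
  ((hY.const_mul _).add stronglyMeasurable_const).add stronglyMeasurable_const

section Demand

variable {Ω : Type*} [mΩ : MeasurableSpace Ω] {P : Measure Ω}
  {σ κ y₀ : ℝ} {μ : ℝ → ℝ} {ν T lam : ℝ≥0} {ρ : Measure ℝ} {W : ℝ≥0 → Ω → ℝ} {N : ℝ≥0 → Ω → ℕ}
  {γ : ℕ → Ω → ℝ} {Y : ℝ≥0 → Ω → ℝ}

theorem stronglyMeasurable_natural (hYm : ∀ t, StronglyMeasurable (Y t)) (t : ℝ≥0) :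
    StronglyMeasurable[Filtration.natural Y hYm t] (Y t) :=
  (Filtration.stronglyAdapted_natural hYm) t

/-- On an event that can be read off the demand up to time `r`, the mean of the demand solves,
from time `r` on, a linear equation in which the jumps act as the additional drift `γ̄ ν`. -/
theorem IsDemandNoise.setIntegral_demand [IsProbabilityMeasure P]
    (h : IsDemandNoise ν ρ W N γ P) (hκ : 0 < κ) (hμ : IntervalIntegrable μ volume 0 T)
    (hYm : ∀ t, StronglyMeasurable (Y t))
    (hsol : ∀ᵐ ω ∂P, IsPathSolution κ y₀ μ T (noise σ W N γ · ω) (Y · ω)) {r s : ℝ≥0}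
    (hrs : r ≤ s) (hsT : s ≤ T) {A : Set Ω} (hA : MeasurableSet[Filtration.natural Y hYm r] A) :
    ∫ ω in A, Y s ω ∂P = ∫ ω in A, (Real.exp (-κ * (s - r)) * Y r ω
      + κ * (∫ u in (r : ℝ)..s, Real.exp (-κ * (s - u)) * μ u)
      + (∫ x, x ∂ρ) * ν / κ * (1 - Real.exp (-κ * (s - r)))) ∂P := by
  have hrs' : (r : ℝ) ≤ s := by exact_mod_cast hrs
  have hYi : ∀ t ≤ T, Integrable (Y t) P := fun t ht =>
    (h.memLp_demand hκ.le hμ hYm hsol ht).integrable one_le_two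
  set p := P.real A with hp
  set c := ∫ x, x ∂ρ
  set q : ℝ → ℝ := fun u => p * (κ * μ u + c * ν)
  have hμrs : IntervalIntegrable μ volume r s := hμ.mono_set (by
    rw [Set.uIcc_of_le hrs', Set.uIcc_of_le T.coe_nonneg]
    exact Set.Icc_subset_Icc r.coe_nonneg (by exact_mod_cast hsT))
  have hq : IntervalIntegrable q volume r s :=
    ((hμrs.const_mul κ).add intervalIntegrable_const).const_mul p
  have hYprod : Integrable (fun z : ℝ × Ω => Y z.1.toNNReal z.2)
      ((volume.restrict (Set.Ioc (r : ℝ) s)).prod (P.restrict A)) := by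
    have h1 := (h.memLp_demand_prod hκ.le hμ hYm hsol).integrable one_le_two
    refine h1.mono_measure
      (Measure.prod_mono (Measure.restrict_mono ?_ le_rfl) Measure.restrict_le_self)
    exact fun u hu => ⟨r.coe_nonneg.trans hu.1.le, hu.2.trans (by exact_mod_cast hsT)⟩
  have hf : IntervalIntegrable (fun u : ℝ => ∫ ω in A, Y u.toNNReal ω ∂P) volume r s := by
    rw [intervalIntegrable_iff_integrableOn_Ioc_of_le hrs']
    exact hYprod.integral_prod_left
  have hmain : ∀ t ∈ Set.Icc (r : ℝ) s, ∫ ω in A, Y t.toNNReal ω ∂P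
      = ∫ ω in A, Y r ω ∂P + ∫ u in (r : ℝ)..t, (q u - κ * ∫ ω in A, Y u.toNNReal ω ∂P) := by
    intro t ht
    have ht0 : 0 ≤ t := r.coe_nonneg.trans ht.1
    have hrt : r ≤ t.toNNReal := NNReal.le_toNNReal_of_coe_le ht.1
    have htT : t.toNNReal ≤ T := (Real.toNNReal_le_iff_le_coe.2 ht.2).trans hsT
    have hsub : Set.Ioc (r : ℝ) t ⊆ Set.Ioc (r : ℝ) s := Set.Ioc_subset_Ioc_right ht.2
    have hμrt : IntegrableOn μ (Set.Ioc (r : ℝ) t) :=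
      ((intervalIntegrable_iff_integrableOn_Ioc_of_le hrs').1 hμrs).mono_set hsub
    have hD : Integrable (fun z : ℝ × Ω => κ * (μ z.1 - Y z.1.toNNReal z.2))
        ((volume.restrict (Set.Ioc (r : ℝ) t)).prod (P.restrict A)) :=
      ((hμrt.comp_fst _).sub (hYprod.mono_measure
        (Measure.prod_mono (Measure.restrict_mono hsub le_rfl) le_rfl))).const_mul κ
    have hpath : ∀ᵐ ω ∂P, Y t.toNNReal ω - Y r ω
        - (noise σ W N γ t.toNNReal ω - noise σ W N γ r ω)
        = ∫ u in Set.Ioc (r : ℝ) t, κ * (μ u - Y u.toNNReal ω) := by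
      filter_upwards [hsol] with ω hω
      have hi := hω.intervalIntegrable_drift hμ
      have hm : ∀ v : ℝ≥0, v ≤ T → IntervalIntegrable (fun s => κ * (μ s - Y s.toNNReal ω))
          volume 0 v := fun v hv => hi.mono_set (Set.uIcc_subset_uIcc_left (by simp [hv]))
      have e1 : Y t.toNNReal ω = _ := hω.2 _ htT
      have e2 : Y r ω = _ := hω.2 r (hrs.trans hsT)
      rw [e1, e2, ← intervalIntegral.integral_of_le ht.1,
        ← intervalIntegral.integral_interval_sub_left (a := 0)
          (by simpa [ht0] using hm _ htT) (hm r (hrs.trans hsT)), Real.coe_toNNReal t ht0]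
      ring
    have hX := h.setIntegral_noise_increment hμ hYm hsol (hrs.trans hsT) hrt hA
    have hXi : ∀ t, Integrable (noise σ W N γ t) P := fun t =>
      (h.memLp_noise t).integrable one_le_two
    -- Fubini's theorem, for the drift on the event `A`
    have hfub : ∫ ω in A, (∫ u in Set.Ioc (r : ℝ) t, κ * (μ u - Y u.toNNReal ω)) ∂P
        = ∫ u in Set.Ioc (r : ℝ) t, (p * (κ * μ u) - κ * ∫ ω in A, Y u.toNNReal ω ∂P) := by
      rw [← integral_integral_swap hD]
      refine setIntegral_congr_fun measurableSet_Ioc fun u hu => ?_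
      have huT : u.toNNReal ≤ T := Real.toNNReal_le_iff_le_coe.2
        (hu.2.trans (ht.2.trans (by exact_mod_cast hsT)))
      rw [integral_const_mul, integral_sub (integrable_const _) (hYi _ huT).integrableOn,
        integral_const, smul_eq_mul, measureReal_restrict_apply MeasurableSet.univ, Set.univ_inter]
      ring
    have hlhs := integral_congr_ae (ae_restrict_of_ae (s := A) hpath)
    have i1 : Integrable (fun ω => Y t.toNNReal ω - Y r ω) P :=
      (hYi _ htT).sub (hYi r (hrs.trans hsT))
    have i2 : Integrable (fun ω => noise σ W N γ t.toNNReal ω - noise σ W N γ r ω) P :=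
      (hXi _).sub (hXi _)
    rw [hfub, integral_sub i1.integrableOn i2.integrableOn, hX,
      integral_sub (hYi _ htT).integrableOn (hYi r (hrs.trans hsT)).integrableOn,
      ← intervalIntegral.integral_of_le ht.1, Real.coe_toNNReal t ht0] at hlhs
    have hft : IntervalIntegrable (fun u : ℝ => κ * ∫ ω in A, Y u.toNNReal ω ∂P) volume r t := by
      refine (hf.mono_set ?_).const_mul κ
      rw [Set.uIcc_of_le ht.1, Set.uIcc_of_le hrs']
      exact Set.Icc_subset_Icc_right ht.2
    have hμt : IntervalIntegrable (fun u => p * (κ * μ u)) volume r t :=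
      (((intervalIntegrable_iff_integrableOn_Ioc_of_le ht.1).2 hμrt).const_mul κ).const_mul p
    have hsplit : ∫ u in (r : ℝ)..t, (q u - κ * ∫ ω in A, Y u.toNNReal ω ∂P)
        = (∫ u in (r : ℝ)..t, (p * (κ * μ u) - κ * ∫ ω in A, Y u.toNNReal ω ∂P))
          + p * (c * ν * (t - r)) := by
      have : ∀ u, q u - κ * ∫ ω in A, Y u.toNNReal ω ∂P
          = (p * (κ * μ u) - κ * ∫ ω in A, Y u.toNNReal ω ∂P) + p * (c * ν) := fun u => by
        simp only [q]; ring
      simp_rw [this]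
      rw [intervalIntegral.integral_add (hμt.sub hft) intervalIntegrable_const,
        intervalIntegral.integral_const, smul_eq_mul]
      ring
    rw [hsplit, ← hlhs]
    ring
  have hsolve := eq_of_linear_integral_equation hrs' hq hf hmain
  rw [Real.toNNReal_coe] at hsolve
  rw [hsolve]
  have hμe := intervalIntegrable_exp_mul (κ := κ) (c := s) hμrs
  have hce : IntervalIntegrable (fun u : ℝ => Real.exp (-κ * (s - u)) * κ) volume r s :=
    (by fun_prop : Continuous fun u : ℝ => Real.exp (-κ * (s - u)) * κ).intervalIntegrable _ _
  have hI : ∫ u in (r : ℝ)..s, Real.exp (-κ * (s - u)) * q u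
      = p * (κ * (∫ u in (r : ℝ)..s, Real.exp (-κ * (s - u)) * μ u)
        + c * ν / κ * (1 - Real.exp (-κ * (s - r)))) := by
    rw [← integral_mul_exp_eq κ hrs', ← intervalIntegral.integral_const_mul,
      ← intervalIntegral.integral_const_mul,
      ← intervalIntegral.integral_add (hμe.const_mul _) (hce.const_mul _),
      ← intervalIntegral.integral_const_mul]
    refine intervalIntegral.integral_congr fun u _ => ?_
    simp only [q]
    field_simp
  rw [hI]
  have hYr := (hYi r (hrs.trans hsT)).integrableOn (s := A)
  simp only [add_assoc]
  rw [integral_add (hYr.const_mul _) (integrable_const _), integral_const_mul, integral_const,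
    smul_eq_mul, measureReal_restrict_apply MeasurableSet.univ, Set.univ_inter]

theorem IsDemandNoise.control_ae_eq_condExp [IsProbabilityMeasure P]
    (h : IsDemandNoise ν ρ W N γ P) (hκ : 0 < κ) (hμ : IntervalIntegrable μ volume 0 T)
    (hYm : ∀ t, StronglyMeasurable (Y t))
    (hsol : ∀ᵐ ω ∂P, IsPathSolution κ y₀ μ T (noise σ W N γ · ω) (Y · ω)) {r t : ℝ≥0}
    (hrt : r ≤ t) (htT : t + 1 / lam ≤ T) :
    control κ (∫ x, x ∂ρ) ν lam μ Y t r
      =ᵐ[P] P[Y (t + 1 / lam) | Filtration.natural Y hYm r] := by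
  have hrs : r ≤ t + 1 / lam := hrt.trans le_self_add
  have hint : ∀ u ≤ T, Integrable (Y u) P := fun u hu =>
    (h.memLp_demand hκ.le hμ hYm hsol hu).integrable one_le_two
  have hci : Integrable (control κ (∫ x, x ∂ρ) ν lam μ Y t r) P :=
    (((hint r (hrs.trans htT)).const_mul _).add (integrable_const _)).add (integrable_const _)
  refine ae_eq_condExp_of_forall_setIntegral_eq (Filtration.le _ r) (hint _ htT)
    (fun A _ _ => hci.integrableOn) (fun A hA _ => ?_)
    (stronglyMeasurable_control (stronglyMeasurable_natural hYm r)).aestronglyMeasurable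
  rw [h.setIntegral_demand hκ hμ hYm hsol hrs htT hA]
  simp only [control]
  push_cast
  rfl

end Demand

/-! ### The control problem -/

/-- Up to the term with the observed demand, the control is a continuous function of the time at
which it acts and of the time of the observation. -/
theorem exists_continuous_control_eq (κ γbar : ℝ) (ν lam : ℝ≥0) {T : ℝ≥0} {μ : ℝ → ℝ}
    (hμ : IntervalIntegrable μ volume 0 T) :
    ∃ D : ℝ × ℝ → ℝ, Continuous D ∧
      ∀ {Ω : Type*} (Y : ℝ≥0 → Ω → ℝ) (t r : ℝ≥0) (ω : Ω), r ≤ t → t + 1 / lam ≤ T →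
        control κ γbar ν lam μ Y t r ω
          = Real.exp (-κ * (t + 1 / lam - r)) * Y r ω + D (t, r) := by
  -- outside of `[0, T]`, where nothing is known about `μ`, it is replaced by zero
  set g : ℝ → ℝ := fun s => Real.exp (κ * s) * (Set.Icc 0 (T : ℝ)).indicator μ s with hg
  have hind : Integrable ((Set.Icc 0 (T : ℝ)).indicator μ) := by
    rw [integrable_indicator_iff measurableSet_Icc]
    exact (intervalIntegrable_iff_integrableOn_Icc_of_le T.coe_nonneg).1 hμ
  have hgi : ∀ a b, IntervalIntegrable g volume a b := fun a b =>
    hind.intervalIntegrable.continuousOn_mul (by fun_prop)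
  have hM : Continuous fun x => ∫ s in (0 : ℝ)..x, g s :=
    intervalIntegral.continuous_primitive hgi 0
  refine ⟨fun p => κ * (Real.exp (-κ * (p.1 + 1 / lam))
      * ((∫ s in (0 : ℝ)..(p.1 + 1 / lam), g s) - ∫ s in (0 : ℝ)..p.2, g s))
      + γbar * ν / κ * (1 - Real.exp (-κ * (p.1 + 1 / lam - p.2))), ?_, ?_⟩
  · have h1 : Continuous fun p : ℝ × ℝ => ∫ s in (0 : ℝ)..(p.1 + 1 / lam), g s :=
      hM.comp (by fun_prop)
    have h2 : Continuous fun p : ℝ × ℝ => ∫ s in (0 : ℝ)..p.2, g s := hM.comp continuous_snd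
    fun_prop
  · intro Ω Y t r ω hrt htT
    have htT' : (t : ℝ) + 1 / lam ≤ T := by exact_mod_cast htT
    have hr : (r : ℝ) ≤ t + 1 / lam := by exact_mod_cast hrt.trans le_self_add
    have : ∫ s in (r : ℝ)..(t + 1 / lam), Real.exp (-κ * (t + 1 / lam - s)) * μ s
        = Real.exp (-κ * (t + 1 / lam))
          * ((∫ s in (0 : ℝ)..(t + 1 / lam), g s) - ∫ s in (0 : ℝ)..r, g s) := by
      rw [intervalIntegral.integral_interval_sub_left (hgi _ _) (hgi _ _),
        ← intervalIntegral.integral_const_mul]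
      refine intervalIntegral.integral_congr fun s hs => ?_
      rw [Set.uIcc_of_le hr] at hs
      have hs' : s ∈ Set.Icc 0 (T : ℝ) := ⟨r.coe_nonneg.trans hs.1, hs.2.trans htT'⟩
      simp only [hg, Set.indicator_of_mem hs']
      rw [← mul_assoc, ← Real.exp_add]
      ring_nf
    simp only [control, this]
    ring

/-- By the translation `s = t + 1/λ`, the line drops out of the objective. -/
theorem cost_eq {Ω : Type*} [MeasurableSpace Ω] {P : Measure Ω} {lam : ℝ≥0} (hlam : 0 < lam)
    (T : ℝ≥0) (z₀ : ℝ → ℝ) (Y u : ℝ≥0 → Ω → ℝ) :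
    cost lam T z₀ P Y u = ∫⁻ t in Set.Icc (0 : ℝ) (T - 1 / lam),
      ∫⁻ ω, ENNReal.ofReal ((Y (t.toNNReal + 1 / lam) ω - u t.toNNReal ω) ^ 2) ∂P := by
  rw [cost, ← (measurePreserving_add_right volume (1 / lam : ℝ)).setLIntegral_comp_preimage_emb
    (measurableEmbedding_addRight _), Set.preimage_add_const_Icc, sub_self]
  refine setLIntegral_congr_fun measurableSet_Icc fun t ht => ?_
  have : (t + 1 / lam : ℝ).toNNReal = t.toNNReal + 1 / lam := by
    rw [Real.toNNReal_add ht.1 (by positivity), ← NNReal.coe_one, ← NNReal.coe_div,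
      Real.toNNReal_coe]
  simp only [this, outflow_add hlam]

/-- Pythagoras' theorem for the orthogonal projection of `f` to the `m`-measurable functions. -/
theorem lintegral_sq_sub_eq_add {Ω : Type*} {m mΩ : MeasurableSpace Ω} {P : Measure Ω}
    [IsProbabilityMeasure P] (hm : m ≤ mΩ) {f g c : Ω → ℝ} (hf : MemLp f 2 P) (hg : MemLp g 2 P)
    (hc : MemLp c 2 P) (hgm : StronglyMeasurable[m] g) (hcm : StronglyMeasurable[m] c)
    (hcf : c =ᵐ[P] P[f | m]) :
    ∫⁻ ω, ENNReal.ofReal ((f ω - g ω) ^ 2) ∂P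
      = ∫⁻ ω, ENNReal.ofReal ((f ω - c ω) ^ 2) ∂P + ∫⁻ ω, ENNReal.ofReal ((g ω - c ω) ^ 2) ∂P := by
  have hgc : MemLp (fun ω => g ω - c ω) 2 P := hg.sub hc
  have hfc : MemLp (fun ω => f ω - c ω) 2 P := hf.sub hc
  have hfg : MemLp (fun ω => f ω - g ω) 2 P := hf.sub hg
  have i1 : Integrable (fun ω => (g ω - c ω) * f ω) P := hgc.integrable_mul hf
  have i2 : Integrable (fun ω => (g ω - c ω) * c ω) P := hgc.integrable_mul hc
  have horth : ∫ ω, (g ω - c ω) * f ω ∂P = ∫ ω, (g ω - c ω) * c ω ∂P := by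
    have h := condExp_mul_of_stronglyMeasurable_left (hgm.sub hcm) i1 (hf.integrable one_le_two)
    rw [← integral_condExp hm]
    refine integral_congr_ae ?_
    filter_upwards [h, hcf] with ω h1 h2
    refine h1.trans ?_
    rw [Pi.mul_apply, ← h2, Pi.sub_apply]
  have key : ∫ ω, (f ω - g ω) ^ 2 ∂P = ∫ ω, (f ω - c ω) ^ 2 ∂P + ∫ ω, (g ω - c ω) ^ 2 ∂P := by
    have e : ∀ ω, (f ω - g ω) ^ 2 = ((f ω - c ω) ^ 2 + (g ω - c ω) ^ 2)
        - 2 * ((g ω - c ω) * f ω - (g ω - c ω) * c ω) := fun ω => by ring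
    simp_rw [e]
    have i3 : Integrable (fun ω => (f ω - c ω) ^ 2 + (g ω - c ω) ^ 2) P :=
      hfc.integrable_sq.add hgc.integrable_sq
    have i4 : Integrable (fun ω => 2 * ((g ω - c ω) * f ω - (g ω - c ω) * c ω)) P :=
      (i1.sub i2).const_mul 2
    rw [integral_sub i3 i4, integral_add hfc.integrable_sq hgc.integrable_sq, integral_const_mul,
      integral_sub i1 i2, horth, sub_self, mul_zero, sub_zero]
  rw [← ofReal_integral_eq_lintegral_ofReal hfg.integrable_sq (ae_of_all _ fun ω => sq_nonneg _),
    ← ofReal_integral_eq_lintegral_ofReal hfc.integrable_sq (ae_of_all _ fun ω => sq_nonneg _),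
    ← ofReal_integral_eq_lintegral_ofReal hgc.integrable_sq (ae_of_all _ fun ω => sq_nonneg _),
    key, ENNReal.ofReal_add (integral_nonneg fun ω => sq_nonneg _)
      (integral_nonneg fun ω => sq_nonneg _)]

section Demand

variable {Ω : Type*} [mΩ : MeasurableSpace Ω] {P : Measure Ω}
  {σ κ y₀ : ℝ} {μ : ℝ → ℝ} {ν T lam : ℝ≥0} {ρ : Measure ℝ} {W : ℝ≥0 → Ω → ℝ} {N : ℝ≥0 → Ω → ℕ}
  {γ : ℕ → Ω → ℝ} {Y : ℝ≥0 → Ω → ℝ}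

theorem add_one_div_le_of_mem_Icc {lam T : ℝ≥0} {t : ℝ}
    (ht : t ∈ Set.Icc (0 : ℝ) (T - 1 / lam)) : t.toNNReal + 1 / lam ≤ T := by
  rw [← NNReal.coe_le_coe]
  push_cast
  rw [Real.coe_toNNReal t ht.1]
  linarith [ht.2]

theorem IsDemandNoise.isAdmissible_control [IsProbabilityMeasure P]
    (h : IsDemandNoise ν ρ W N γ P) (hκ : 0 < κ) (hμ : IntervalIntegrable μ volume 0 T)
    (hYm : ∀ t, StronglyMeasurable (Y t))
    (hsol : ∀ᵐ ω ∂P, IsPathSolution κ y₀ μ T (noise σ W N γ · ω) (Y · ω)) (γbar : ℝ)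
    {τ : ℝ≥0 → ℝ≥0} (hτ : ∀ t, τ t ≤ t) (hτm : Measurable τ)
    (hYτ : AEStronglyMeasurable (fun p : ℝ × Ω => Y (τ p.1.toNNReal) p.2)
      ((volume.restrict (Set.Icc (0 : ℝ) (T - 1 / lam))).prod P)) :
    IsAdmissible lam T P (Filtration.natural Y hYm) τ
      (fun t => control κ γbar ν lam μ Y t (τ t)) := by
  refine ⟨fun t _ => stronglyMeasurable_control (stronglyMeasurable_natural hYm _), ?_⟩
  have hmem : ∀ᵐ p ∂(volume.restrict (Set.Icc (0 : ℝ) (T - 1 / lam))).prod P,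
      p.1 ∈ Set.Icc (0 : ℝ) (T - 1 / lam) :=
    Measure.quasiMeasurePreserving_fst.ae (ae_restrict_mem measurableSet_Icc)
  obtain ⟨D, hD, hcontrol⟩ := exists_continuous_control_eq κ γbar ν lam hμ
  obtain ⟨C, hC, hYC⟩ := h.exists_lintegral_demand_sq_le hκ.le hμ hsol
  have hY2 : MemLp (fun p : ℝ × Ω => Y (τ p.1.toNNReal) p.2) 2
      ((volume.restrict (Set.Icc (0 : ℝ) (T - 1 / lam))).prod P) := by
    refine memLp_two_of_lintegral_ne_top hYτ ?_
    rw [lintegral_prod _ (hYτ.aemeasurable.pow_const 2).ennreal_ofReal]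
    refine ((setLIntegral_mono (g := fun _ => C) measurable_const fun s hs => ?_).trans_lt ?_).ne
    · exact hYC _ ((hτ _).trans (le_self_add.trans (add_one_div_le_of_mem_Icc hs)))
    · rw [setLIntegral_const, Real.volume_Icc]
      finiteness
  have hw : Measurable fun p : ℝ × Ω =>
      Real.exp (-κ * ((p.1.toNNReal : ℝ) + 1 / lam - τ p.1.toNNReal)) := by fun_prop
  have h1 : MemLp (fun p : ℝ × Ω =>
      Real.exp (-κ * ((p.1.toNNReal : ℝ) + 1 / lam - τ p.1.toNNReal)) * Y (τ p.1.toNNReal) p.2) 2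
      ((volume.restrict (Set.Icc (0 : ℝ) (T - 1 / lam))).prod P) := by
    refine hY2.of_le (hw.aestronglyMeasurable.mul hYτ) (ae_of_all _ fun p => ?_)
    rw [norm_mul]
    refine mul_le_of_le_one_left (norm_nonneg _) ?_
    rw [Real.norm_eq_abs, Real.abs_exp, Real.exp_le_one_iff]
    have : (τ p.1.toNNReal : ℝ) ≤ p.1.toNNReal := by exact_mod_cast hτ _
    have : 0 ≤ (1 / lam : ℝ) := by positivity
    nlinarith
  obtain ⟨B, hB⟩ := ((isCompact_Icc (a := (0 : ℝ)) (b := T)).prod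
    (isCompact_Icc (a := (0 : ℝ)) (b := T))).exists_bound_of_continuousOn hD.continuousOn
  have h2 : MemLp (fun p : ℝ × Ω => D (p.1.toNNReal, τ p.1.toNNReal)) 2
      ((volume.restrict (Set.Icc (0 : ℝ) (T - 1 / lam))).prod P) := by
    refine MemLp.of_bound (Measurable.aestronglyMeasurable ?_) B ?_
    · exact hD.measurable.comp (by fun_prop)
    · filter_upwards [hmem] with p hp
      have h3 : p.1.toNNReal ≤ T := le_self_add.trans (add_one_div_le_of_mem_Icc hp)
      exact hB _ ⟨⟨NNReal.coe_nonneg _, by exact_mod_cast h3⟩,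
        ⟨NNReal.coe_nonneg _, by exact_mod_cast (hτ _).trans h3⟩⟩
  refine (h1.add h2).ae_eq ?_
  filter_upwards [hmem] with p hp
  exact (hcontrol Y _ _ _ (hτ _) (add_one_div_le_of_mem_Icc hp)).symm

/-- The cost of a control exceeds that of the conditional expectation of the later demand by the
squared distance of the two. -/
theorem IsDemandNoise.cost_eq_cost_control_add [IsProbabilityMeasure P]
    (h : IsDemandNoise ν ρ W N γ P) (hκ : 0 < κ) (hlam : 0 < lam)
    (hμ : IntervalIntegrable μ volume 0 T) (hYm : ∀ t, StronglyMeasurable (Y t))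
    (hsol : ∀ᵐ ω ∂P, IsPathSolution κ y₀ μ T (noise σ W N γ · ω) (Y · ω)) (z₀ : ℝ → ℝ)
    {τ : ℝ≥0 → ℝ≥0} (hτ : ∀ t, τ t ≤ t)
    (hu : IsAdmissible lam T P (Filtration.natural Y hYm) τ
      (fun t => control κ (∫ x, x ∂ρ) ν lam μ Y t (τ t)))
    {v : ℝ≥0 → Ω → ℝ} (hv : IsAdmissible lam T P (Filtration.natural Y hYm) τ v) :
    cost lam T z₀ P Y v
      = cost lam T z₀ P Y (fun t => control κ (∫ x, x ∂ρ) ν lam μ Y t (τ t))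
        + ∫⁻ p : ℝ × Ω, ENNReal.ofReal ((v p.1.toNNReal p.2
            - control κ (∫ x, x ∂ρ) ν lam μ Y p.1.toNNReal (τ p.1.toNNReal) p.2) ^ 2)
          ∂((volume.restrict (Set.Icc (0 : ℝ) (T - 1 / lam))).prod P) := by
  have hd : AEMeasurable (fun p : ℝ × Ω => ENNReal.ofReal ((v p.1.toNNReal p.2
      - control κ (∫ x, x ∂ρ) ν lam μ Y p.1.toNNReal (τ p.1.toNNReal) p.2) ^ 2))
      ((volume.restrict (Set.Icc (0 : ℝ) (T - 1 / lam))).prod P) :=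
    ((hv.memLp.aestronglyMeasurable.sub hu.memLp.aestronglyMeasurable).aemeasurable.pow_const
      2).ennreal_ofReal
  rw [cost_eq hlam, cost_eq hlam, lintegral_prod _ hd,
    ← lintegral_add_right' _ hd.lintegral_prod_right']
  have hsec : ∀ {w : ℝ≥0 → Ω → ℝ}, IsAdmissible lam T P (Filtration.natural Y hYm) τ w →
      ∀ᵐ t ∂volume.restrict (Set.Icc (0 : ℝ) (T - 1 / lam)), MemLp (w t.toNNReal) 2 P := by
    intro w hw
    filter_upwards [hw.memLp.integrable_sq.prod_right_ae, ae_restrict_mem measurableSet_Icc]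
      with t h1 ht
    exact (memLp_two_iff_integrable_sq ((hw.adapted _ (add_one_div_le_of_mem_Icc ht)).mono
      (Filtration.le _ _)).aestronglyMeasurable).2 h1
  refine lintegral_congr_ae ?_
  filter_upwards [hsec hu, hsec hv, ae_restrict_mem measurableSet_Icc] with t h1 h2 ht
  have htT := add_one_div_le_of_mem_Icc ht
  exact lintegral_sq_sub_eq_add (Filtration.le _ _) (h.memLp_demand hκ.le hμ hYm hsol htT) h2 h1
    (hv.adapted _ htT) (hu.adapted _ htT) (h.control_ae_eq_condExp hκ hμ hYm hsol (hτ _) htT)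

theorem IsDemandNoise.isOptimalControl [IsProbabilityMeasure P]
    (h : IsDemandNoise ν ρ W N γ P) (hκ : 0 < κ) (hlam : 0 < lam)
    (hμ : IntervalIntegrable μ volume 0 T) (hYm : ∀ t, StronglyMeasurable (Y t))
    (hsol : ∀ᵐ ω ∂P, IsPathSolution κ y₀ μ T (noise σ W N γ · ω) (Y · ω)) (z₀ : ℝ → ℝ)
    {τ : ℝ≥0 → ℝ≥0} (hτ : ∀ t, τ t ≤ t) (hτm : Measurable τ)
    (hYτ : AEStronglyMeasurable (fun p : ℝ × Ω => Y (τ p.1.toNNReal) p.2)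
      ((volume.restrict (Set.Icc (0 : ℝ) (T - 1 / lam))).prod P)) :
    IsOptimalControl lam T z₀ P (Filtration.natural Y hYm) Y τ
      (fun t => control κ (∫ x, x ∂ρ) ν lam μ Y t (τ t)) := by
  have hu := h.isAdmissible_control (lam := lam) hκ hμ hYm hsol (∫ x, x ∂ρ) hτ hτm hYτ
  have hcost := fun v hv => h.cost_eq_cost_control_add (v := v) hκ hlam hμ hYm hsol z₀ hτ hu hv
  have hmin := fun v hv => le_self_add.trans_eq (hcost v hv).symm
  have hfin : cost lam T z₀ P Y (fun t => control κ (∫ x, x ∂ρ) ν lam μ Y t (τ t)) < ∞ := by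
    -- the cost of the control `0` is the time integral of the second moment of the demand
    obtain ⟨C, hC, hYC⟩ := h.exists_lintegral_demand_sq_le hκ.le hμ hsol
    have h0 : IsAdmissible lam T P (Filtration.natural Y hYm) τ (fun _ _ => 0) :=
      ⟨fun t _ => stronglyMeasurable_const, MemLp.zero⟩
    refine (hmin _ h0).trans_lt ?_
    rw [cost_eq hlam]
    refine (setLIntegral_mono (g := fun _ => C) measurable_const fun s hs => ?_).trans_lt ?_
    · simpa using hYC _ (add_one_div_le_of_mem_Icc hs)
    · rw [setLIntegral_const, Real.volume_Icc]
      finiteness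
  refine ⟨⟨hu, hmin⟩, hfin, fun v hv => ?_⟩
  have hle := hv.2 _ hu
  rw [hcost v hv.1] at hle
  have hzero : ∫⁻ p : ℝ × Ω, ENNReal.ofReal ((v p.1.toNNReal p.2
      - control κ (∫ x, x ∂ρ) ν lam μ Y p.1.toNNReal (τ p.1.toNNReal) p.2) ^ 2)
      ∂((volume.restrict (Set.Icc (0 : ℝ) (T - 1 / lam))).prod P) = 0 := by
    refine le_antisymm ?_ zero_le
    exact (ENNReal.add_le_add_iff_left hfin.ne).1 (hle.trans_eq (add_zero _).symm)
  have hd : AEMeasurable (fun p : ℝ × Ω => ENNReal.ofReal ((v p.1.toNNReal p.2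
      - control κ (∫ x, x ∂ρ) ν lam μ Y p.1.toNNReal (τ p.1.toNNReal) p.2) ^ 2))
      ((volume.restrict (Set.Icc (0 : ℝ) (T - 1 / lam))).prod P) :=
    ((hv.1.memLp.aestronglyMeasurable.sub hu.memLp.aestronglyMeasurable).aemeasurable.pow_const
      2).ennreal_ofReal
  filter_upwards [(lintegral_eq_zero_iff' hd).1 hzero] with p hp
  have : (v p.1.toNNReal p.2
      - control κ (∫ x, x ∂ρ) ν lam μ Y p.1.toNNReal (τ p.1.toNNReal) p.2) ^ 2 ≤ 0 :=
    ENNReal.ofReal_eq_zero.1 hp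
  exact sub_eq_zero.1 (pow_eq_zero_iff two_ne_zero |>.1 (le_antisymm this (sq_nonneg _)))

end Demand

/-! ### Regular updates, and their limit -/

theorem lastUpdate_le (Δ t : ℝ≥0) : lastUpdate Δ t ≤ t := by
  rcases eq_zero_or_pos Δ with rfl | hΔ
  · simp [lastUpdate]
  · exact (le_div_iff₀ hΔ).1 (Nat.floor_le zero_le)

theorem le_lastUpdate_add {Δ : ℝ≥0} (hΔ : 0 < Δ) (t : ℝ≥0) : t ≤ lastUpdate Δ t + Δ := by
  have := (div_lt_iff₀ hΔ).1 (Nat.lt_floor_add_one (t / Δ))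
  rw [add_mul, one_mul] at this
  exact this.le

theorem measurable_lastUpdate (Δ : ℝ≥0) : Measurable (lastUpdate Δ) := by
  unfold lastUpdate
  fun_prop

theorem tendsto_lastUpdate (t : ℝ≥0) :
    Tendsto (fun Δ => lastUpdate Δ t) (𝓝[>] 0) (𝓝[≤] t) := by
  refine tendsto_nhdsWithin_iff.2 ⟨?_, Eventually.of_forall fun Δ => lastUpdate_le Δ t⟩
  have h : Tendsto (fun Δ : ℝ≥0 => t - Δ) (𝓝[>] 0) (𝓝 t) := by
    have : Tendsto (fun Δ : ℝ≥0 => t - Δ) (𝓝 0) (𝓝 (t - 0)) :=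
      (continuous_const.sub continuous_id).tendsto 0
    rw [tsub_zero] at this
    exact this.mono_left nhdsWithin_le_nhds
  refine tendsto_of_tendsto_of_tendsto_of_le_of_le' h tendsto_const_nhds ?_
    (Eventually.of_forall fun Δ => lastUpdate_le Δ t)
  filter_upwards [self_mem_nhdsWithin] with Δ hΔ
  exact tsub_le_iff_right.2 (le_lastUpdate_add hΔ t)

theorem measurable_comp_lastUpdate {Ω : Type*} [MeasurableSpace Ω] {Y : ℝ≥0 → Ω → ℝ}
    (hY : ∀ t, Measurable (Y t)) (Δ : ℝ≥0) :
    Measurable fun p : ℝ × Ω => Y (lastUpdate Δ p.1.toNNReal) p.2 := by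
  have h : Measurable fun p : ℕ × Ω => Y (p.1 * Δ) p.2 :=
    measurable_from_prod_countable_right fun k => hY (k * Δ)
  have hf : Measurable fun s : ℝ => ⌊s.toNNReal / Δ⌋₊ := by fun_prop
  have hm : Measurable fun p : ℝ × Ω => (⌊p.1.toNNReal / Δ⌋₊, p.2) :=
    (hf.comp measurable_fst).prodMk measurable_snd
  exact h.comp hm

section Demand

variable {Ω : Type*} [mΩ : MeasurableSpace Ω] {P : Measure Ω}
  {σ κ y₀ : ℝ} {μ : ℝ → ℝ} {ν T lam : ℝ≥0} {ρ : Measure ℝ} {W : ℝ≥0 → Ω → ℝ} {N : ℝ≥0 → Ω → ℕ}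
  {γ : ℕ → Ω → ℝ} {Y : ℝ≥0 → Ω → ℝ}

/-- At a fixed time the demand is left-continuous, as there is almost surely no jump then. -/
theorem IsDemandNoise.ae_left_continuous_demand [IsProbabilityMeasure P]
    (h : IsDemandNoise ν ρ W N γ P) (hμ : IntervalIntegrable μ volume 0 T)
    (hsol : ∀ᵐ ω ∂P, IsPathSolution κ y₀ μ T (noise σ W N γ · ω) (Y · ω)) {t : ℝ≥0} (ht : t ≤ T) :
    ∀ᵐ ω ∂P, ContinuousWithinAt (Y · ω) (Set.Iic t) t := by
  filter_upwards [hsol, h.brownian.cont, h.poisson.ae_eventually_eq_left t] with ω h1 h2 h3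
  refine h1.continuousWithinAt hμ ht (Set.Iic_subset_Iic.2 ht)
    (continuousWithinAt_noise h2.continuousWithinAt ?_)
  exact tendsto_const_nhds.congr' (h3.mono fun s hs => hs.symm)

theorem IsDemandNoise.ae_tendsto_control [IsProbabilityMeasure P]
    (h : IsDemandNoise ν ρ W N γ P) (hμ : IntervalIntegrable μ volume 0 T)
    (hsol : ∀ᵐ ω ∂P, IsPathSolution κ y₀ μ T (noise σ W N γ · ω) (Y · ω)) (γbar : ℝ) {t : ℝ≥0}
    (ht : t + 1 / lam ≤ T) :
    ∀ᵐ ω ∂P, Tendsto (fun r => control κ γbar ν lam μ Y t r ω) (𝓝[≤] t)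
      (𝓝 (control κ γbar ν lam μ Y t t ω)) := by
  obtain ⟨D, hD, hcontrol⟩ := exists_continuous_control_eq κ γbar ν lam hμ
  filter_upwards [h.ae_left_continuous_demand hμ hsol (le_self_add.trans ht)] with ω hω
  rw [hcontrol Y t t ω le_rfl ht]
  have h1 : Continuous fun r : ℝ≥0 => Real.exp (-κ * ((t : ℝ) + 1 / lam - r)) := by fun_prop
  have h2 : Continuous fun r : ℝ≥0 => D ((t : ℝ), (r : ℝ)) := hD.comp (by fun_prop)
  refine ((h1.continuousWithinAt.mul hω).add h2.continuousWithinAt).tendsto.congr' ?_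
  filter_upwards [self_mem_nhdsWithin] with r hr
  exact (hcontrol Y t r ω hr ht).symm

end Demand

end PowerSupply

theorem theorem3p4 {Ω : Type*} [MeasurableSpace Ω] (P : Measure Ω) [IsProbabilityMeasure P]
    -- parameters
    (κ σ y₀ : ℝ) (ν lam T : ℝ≥0) (hκ : 0 < κ) (hσ : 0 < σ) (hν : 0 < ν) (hlam : 0 < lam)
    (hT : 1 / lam ≤ T) (z₀ : ℝ → ℝ)
    (μ : ℝ → ℝ) (hμ : IntervalIntegrable μ volume 0 T)
    -- Brownian motion, Poisson process, i.i.d. square integrable jump heights, all independent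
    (W : ℝ≥0 → Ω → ℝ) (hWm : ∀ t, Measurable (W t)) (hW : IsBrownianReal W P)
    (N : ℝ≥0 → Ω → ℕ) (hN : PowerSupply.IsPoissonProcess N ν P)
    (ρ : Measure ℝ) (hρ : MemLp id 2 ρ)
    (γ : ℕ → Ω → ℝ) (hγm : ∀ i, Measurable (γ i)) (hγ : ∀ i, HasLaw (γ i) ρ P)
    (hγi : iIndepFun γ P)
    (hWN : IndepFun (fun ω t => W t ω) (fun ω t => N t ω) P)
    (hγWN : IndepFun (fun ω i => γ i ω) (fun ω => ((fun t => W t ω), (fun t => N t ω))) P)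
    -- the demand, and the information that it generates
    (Y : ℝ≥0 → Ω → ℝ) (hYm : ∀ t, StronglyMeasurable (Y t))
    (hY : PowerSupply.SolvesJumpDiffusion κ σ y₀ μ T W N γ Y P) :
    -- the optimal controls with updates at the times `i Δ`
    (∀ Δ : ℝ≥0, 0 < Δ →
      PowerSupply.IsOptimalControl lam T z₀ P (Filtration.natural Y hYm) Y
        (PowerSupply.lastUpdate Δ)
        (fun t => PowerSupply.control κ (∫ x, x ∂ρ) ν lam μ Y t (PowerSupply.lastUpdate Δ t))) ∧
    -- the optimal control in the idealized setting
    PowerSupply.IsOptimalControl lam T z₀ P (Filtration.natural Y hYm) Y (fun t => t)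
      (fun t => PowerSupply.control κ (∫ x, x ∂ρ) ν lam μ Y t t) ∧
    -- at each fixed time, these controls are the conditional expectations of the later demand
    (∀ r t : ℝ≥0, r ≤ t → t + 1 / lam ≤ T →
      PowerSupply.control κ (∫ x, x ∂ρ) ν lam μ Y t r
        =ᵐ[P] P[Y (t + 1 / lam) | Filtration.natural Y hYm r]) ∧
    -- convergence
    ∀ t : ℝ≥0, t + 1 / lam ≤ T → ∀ᵐ ω ∂P,
      Tendsto (fun Δ : ℝ≥0 =>
          PowerSupply.control κ (∫ x, x ∂ρ) ν lam μ Y t t ω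
            - PowerSupply.control κ (∫ x, x ∂ρ) ν lam μ Y t (PowerSupply.lastUpdate Δ t) ω)
        (𝓝[>] 0) (𝓝 0) := by
  have hnoise : PowerSupply.IsDemandNoise ν ρ W N γ P :=
    ⟨hWm, hW, hN, hρ, hγm, hγ, hγi, hWN, hγWN⟩
  have hsol : ∀ᵐ ω ∂P,
      PowerSupply.IsPathSolution κ y₀ μ T (PowerSupply.noise σ W N γ · ω) (Y · ω) := by
    filter_upwards [hY] with ω hω
    exact ⟨hω.1, fun t ht => (hω.2 t ht).trans (add_assoc _ _ _)⟩
  refine ⟨fun Δ _ => ?_, ?_, fun r t hrt htT => ?_, fun t htT => ?_⟩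
  · exact hnoise.isOptimalControl hκ hlam hμ hYm hsol z₀
      (fun t => PowerSupply.lastUpdate_le Δ t) (PowerSupply.measurable_lastUpdate Δ)
      (PowerSupply.measurable_comp_lastUpdate (fun t => (hYm t).measurable) Δ).aestronglyMeasurable
  · refine hnoise.isOptimalControl hκ hlam hμ hYm hsol z₀ (fun _ => le_rfl) measurable_id ?_
    refine (hnoise.memLp_demand_prod hκ.le hμ hYm hsol).aestronglyMeasurable.mono_measure
      (Measure.prod_mono (Measure.restrict_mono (Set.Icc_subset_Icc_right ?_) le_rfl) le_rfl)
    exact sub_le_self _ (by positivity)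
  · exact hnoise.control_ae_eq_condExp hκ hμ hYm hsol hrt htT
  · filter_upwards [hnoise.ae_tendsto_control (lam := lam) hμ hsol (∫ x, x ∂ρ) htT] with ω hω
    have h := (hω.comp (PowerSupply.tendsto_lastUpdate t)).const_sub
      (PowerSupply.control κ (∫ x, x ∂ρ) ν lam μ Y t t ω)
    rwa [sub_self] at h
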